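/- Let $p$ be an odd prime, $K$ a field of characteristic $p$, $G$ a finite cyclic group with $p \mid |G|$, and $A = KG$ its group algebra. Let $HH^n(A)$ ($n\ge 0$) be the Hochschild cohomology of $A$, computed by the Hochschild complex $C^n(A)=\mathrm{Hom}_K(A^{\otimes n},A)$, and let $[\,\cdot\,,\,\cdot\,]$ be the Gerstenhaber bracket. It makes $HH^1(A)$ a Lie algebra and every $HH^n(A)$ a Lie module over $HH^1(A)$. Sending the class of a $1$-cocycle $f$ to the map $a\mapsto f(a)$ is an isomorphism of Lie algebras $\theta: HH^1(A)\to \mathrm{Der}_K(A)$. The Lie algebra $\mathrm{Der}_K(A)$ is the Witt algebra: for every generator $g$ of $G$ it has a $K$-basis $(D_i)_{i\in\mathbb Z/|G|}$ of derivations with $D_i(g)=g^{i+1}$, and $[D_i,D_j]=(j-i)D_{i+j}$, where $j-i$ is computed in $K$ (well defined since $p$ divides $|G|$) and $i+j$ modulo $|G|$. (i) If $n$ is odd, then $HH^n(A)$ is isomorphic to the adjoint module: there is a $K$-linear isomorphism $e: HH^n(A)\to \mathrm{Der}_K(A)$ with $e([D,\xi])=[\theta(D),e(\xi)]$ for all $D\in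 HH^1(A)$, $\xi\in HH^n(A)$. (ii) If $n$ is even, then $HH^n(A)$ is isomorphic to the standard module: there is a $K$-linear isomorphism $e: HH^n(A)\to A$ with $e([D,\xi])=\theta(D)(e(\xi))$ for all $D\in HH^1(A)$, $\xi\in HH^n(A)$. -/

import Mathlib

namespace Hochschild

open Function

/-- Hochschild `n`-cochains `Hom_K(A^{⊗ n}, A)`, written as `K`-multilinear maps `Aⁿ → A`. -/
abbrev Cochain (K A : Type*) [CommRing K] [Ring A] [Algebra K A] (n : ℕ) : Type _ :=
  MultilinearMap K (fun _ : Fin n => A) A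

/-- Mathlib's additive group structure, recorded for `Cochain` so that quotients of submodules
of cochains are found. -/
instance Cochain.instAddCommGroup (K A : Type*) [CommRing K] [Ring A] [Algebra K A] (n : ℕ) :
    AddCommGroup (Cochain K A n) :=
  MultilinearMap.instAddCommGroup

section General

variable {K A : Type*} [CommRing K] [Ring A] [Algebra K A]

/-- Precomposition of a cochain with a map of tuples that is linear in each slot: changing one
entry `x l` of the argument changes a single entry of `P x`, linearly in the new value. -/
def Cochain.pull {n k : ℕ} (f : Cochain K A n) (P : (Fin k → A) → Fin n → A)
    (hP : ∀ (x : Fin k → A) (l : Fin k), ∃ (j : Fin n) (φ : A →ₗ[K] A),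
      ∀ v, P (update x l v) = update (P x) j (φ v)) : Cochain K A k :=
  MultilinearMap.mk' (fun x => f (P x))
    (by
      intro x l a b
      obtain ⟨j, φ, h⟩ := hP x l
      simp only [h, map_add, MultilinearMap.map_update_add])
    (by
      intro x l c a
      obtain ⟨j, φ, h⟩ := hP x l
      simp only [h, map_smul, MultilinearMap.map_update_smul])

theorem contractNth_update {n : ℕ} (i : Fin n) (x : Fin (n + 1) → A) (l : Fin (n + 1)) :
    ∃ (j : Fin n) (φ : A →ₗ[K] A), ∀ v,
      Fin.contractNth i.castSucc (· * ·) (update x l v) =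
        update (Fin.contractNth i.castSucc (· * ·) x) j (φ v) := by
  rcases lt_trichotomy (l : ℕ) i with h | h | h
  · refine ⟨⟨l, by omega⟩, LinearMap.id, fun v => ?_⟩
    funext j
    simp only [Fin.contractNth, update_apply, Fin.ext_iff, Fin.val_castSucc, Fin.val_succ,
      LinearMap.id_apply]
    split_ifs <;> first | rfl | omega
  · refine ⟨i, LinearMap.mulRight K (x i.succ), fun v => ?_⟩
    funext j
    by_cases hj : j = i
    · subst hj
      simp [Fin.contractNth, update_apply, Fin.ext_iff, ← h]
    · have hj' : (j : ℕ) ≠ i := fun e => hj (Fin.ext e)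
      simp only [Fin.contractNth, update_apply, Fin.ext_iff, Fin.val_castSucc, Fin.val_succ]
      split_ifs <;> first | rfl | omega
  · by_cases h' : (l : ℕ) = i + 1
    · refine ⟨i, LinearMap.mulLeft K (x i.castSucc), fun v => ?_⟩
      funext j
      by_cases hj : j = i
      · subst hj
        simp [Fin.contractNth, update_apply, Fin.ext_iff, h']
      · have hj' : (j : ℕ) ≠ i := fun e => hj (Fin.ext e)
        simp only [Fin.contractNth, update_apply, Fin.ext_iff, Fin.val_castSucc, Fin.val_succ]
        split_ifs <;> first | rfl | omega
    · refine ⟨⟨l - 1, by omega⟩, LinearMap.id, fun v => ?_⟩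
      funext j
      simp only [Fin.contractNth, update_apply, Fin.ext_iff, Fin.val_castSucc, Fin.val_succ,
        LinearMap.id_apply]
      split_ifs <;> first | rfl | omega

/-- `(x₀, …, xₙ) ↦ x₀ f(x₁, …, xₙ)`. -/
def Cochain.mulLeft {n : ℕ} (f : Cochain K A n) : Cochain K A (n + 1) :=
  MultilinearMap.mk' (fun x => x 0 * f (Fin.tail x))
    (by
      intro x l a b
      induction l using Fin.cases <;>
        simp [Fin.tail_update_zero, Fin.tail_update_succ, add_mul, mul_add,
          (Fin.succ_ne_zero _).symm])
    (by
      intro x l c a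
      induction l using Fin.cases <;>
        simp [Fin.tail_update_zero, Fin.tail_update_succ,
          (Fin.succ_ne_zero _).symm])

/-- `(x₀, …, xₙ) ↦ f(x₀, …, xₙ₋₁) xₙ`. -/
def Cochain.mulRight {n : ℕ} (f : Cochain K A n) : Cochain K A (n + 1) :=
  MultilinearMap.mk' (fun x => f (Fin.init x) * x (Fin.last n))
    (by
      intro x l a b
      induction l using Fin.lastCases <;>
        simp [Fin.init_update_last, Fin.init_update_castSucc, add_mul, mul_add,
          (Fin.castSucc_lt_last _).ne'])
    (by
      intro x l c a
      induction l using Fin.lastCases <;>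
        simp [Fin.init_update_last, Fin.init_update_castSucc, (Fin.castSucc_lt_last _).ne'])

/-- `(x₀, …, xₙ) ↦ f(x₀, …, xᵢ xᵢ₊₁, …, xₙ)`. -/
def Cochain.contract {n : ℕ} (f : Cochain K A n) (i : Fin n) : Cochain K A (n + 1) :=
  f.pull (Fin.contractNth i.castSucc (· * ·)) (contractNth_update i)

/-- The Hochschild differential
`(δ f)(x₀, …, xₙ) = x₀ f(x₁, …, xₙ) + ∑_{i < n} (-1)^{i+1} f(x₀, …, xᵢ xᵢ₊₁, …, xₙ)
  + (-1)^{n+1} f(x₀, …, xₙ₋₁) xₙ`. -/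
def delta (K A : Type*) [CommRing K] [Ring A] [Algebra K A] (n : ℕ) :
    Cochain K A n →ₗ[K] Cochain K A (n + 1) where
  toFun f := f.mulLeft + ∑ i : Fin n, (-1 : K) ^ ((i : ℕ) + 1) • f.contract i +
    (-1 : K) ^ (n + 1) • f.mulRight
  map_add' f g := by
    ext x
    simp [Cochain.mulLeft, Cochain.mulRight, Cochain.contract, Cochain.pull, mul_add, add_mul,
      Finset.sum_add_distrib, smul_add]
    abel
  map_smul' c f := by
    ext x
    simp [Cochain.mulLeft, Cochain.mulRight, Cochain.contract, Cochain.pull, smul_add,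
      Finset.smul_sum, smul_comm c]

theorem delta_apply {n : ℕ} (f : Cochain K A n) (x : Fin (n + 1) → A) :
    delta K A n f x = x 0 * f (Fin.tail x) +
      ∑ i : Fin n, (-1 : K) ^ ((i : ℕ) + 1) • f (Fin.contractNth i.castSucc (· * ·) x) +
      (-1 : K) ^ (n + 1) • (f (Fin.init x) * x (Fin.last n)) := by
  simp [delta, Cochain.mulLeft, Cochain.mulRight, Cochain.contract, Cochain.pull]

/-- Hochschild cocycles. -/
def cocycles (K A : Type*) [CommRing K] [Ring A] [Algebra K A] (n : ℕ) :
    Submodule K (Cochain K A n) :=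
  LinearMap.ker (delta K A n)

/-- Hochschild coboundaries. -/
def coboundaries (K A : Type*) [CommRing K] [Ring A] [Algebra K A] :
    (n : ℕ) → Submodule K (Cochain K A n)
  | 0 => ⊥
  | n + 1 => LinearMap.range (delta K A n)

/-- The Hochschild cohomology `HHⁿ(A)`, cocycles modulo coboundaries. -/
def HH (K A : Type*) [CommRing K] [Ring A] [Algebra K A] (n : ℕ) : Type _ :=
  cocycles K A n ⧸ (coboundaries K A n).submoduleOf (cocycles K A n)

instance HH.instAddCommGroup (n : ℕ) : AddCommGroup (HH K A n) :=
  inferInstanceAs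
    (AddCommGroup (cocycles K A n ⧸ (coboundaries K A n).submoduleOf (cocycles K A n)))

instance HH.instModule (n : ℕ) : Module K (HH K A n) :=
  inferInstanceAs
    (Module K (cocycles K A n ⧸ (coboundaries K A n).submoduleOf (cocycles K A n)))

/-- The class of a cocycle. -/
def HH.mk (K A : Type*) [CommRing K] [Ring A] [Algebra K A] (n : ℕ) :
    cocycles K A n →ₗ[K] HH K A n :=
  ((coboundaries K A n).submoduleOf (cocycles K A n)).mkQ

theorem HH.mk_surjective (n : ℕ) : Surjective (HH.mk K A n) :=
  Submodule.mkQ_surjective _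

theorem HH.mk_eq_zero {n : ℕ} {f : cocycles K A n} :
    HH.mk K A n f = 0 ↔ (f : Cochain K A n) ∈ coboundaries K A n :=
  Submodule.Quotient.mk_eq_zero _

/-- A linear map on cocycles that kills coboundaries descends to cohomology. -/
def HH.lift {n : ℕ} {M : Type*} [AddCommGroup M] [Module K M] (φ : cocycles K A n →ₗ[K] M)
    (hφ : ∀ f : cocycles K A n, (f : Cochain K A n) ∈ coboundaries K A n → φ f = 0) :
    HH K A n →ₗ[K] M :=
  Submodule.liftQ ((coboundaries K A n).submoduleOf (cocycles K A n)) φ hφ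

theorem HH.lift_mk {n : ℕ} {M : Type*} [AddCommGroup M] [Module K M]
    (φ : cocycles K A n →ₗ[K] M)
    (hφ : ∀ f : cocycles K A n, (f : Cochain K A n) ∈ coboundaries K A n → φ f = 0)
    (f : cocycles K A n) : HH.lift φ hφ (HH.mk K A n f) = φ f :=
  rfl

/-! ### The Gerstenhaber bracket on cochains

The target degree `n + m - 1` is a variable `k` with `k + 1 = n + m`. Positions are counted
from `0`. -/

/-- The tuple `(x₀, …, xᵢ₋₁, g(xᵢ, …, xᵢ₊ₘ₋₁), xᵢ₊ₘ, …, x_{n+m-2})` of length `n`. -/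
def insertArg {n m k : ℕ} (h : k + 1 = n + m) (g : Cochain K A m) (i : Fin n) (x : Fin k → A)
    (j : Fin n) : A :=
  if hlt : j < i then x ⟨j, by have := i.isLt; have := Fin.lt_def.1 hlt; omega⟩
  else if heq : j = i then g fun l => x ⟨i + l, by have := i.isLt; have := l.isLt; omega⟩
  else x ⟨j + m - 1, by
    have := i.isLt; have := j.isLt
    have : (j : ℕ) ≠ i := fun e => heq (Fin.ext e)
    have : ¬ (j : ℕ) < i := fun e => hlt (Fin.lt_def.2 e)
    omega⟩

theorem insertArg_update {n m k : ℕ} (h : k + 1 = n + m) (g : Cochain K A m) (i : Fin n)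
    (x : Fin k → A) (l : Fin k) :
    ∃ (j : Fin n) (φ : A →ₗ[K] A), ∀ v,
      insertArg h g i (update x l v) = update (insertArg h g i x) j (φ v) := by
  have hi := i.isLt
  have hl := l.isLt
  by_cases h1 : (l : ℕ) < i
  · refine ⟨⟨l, by omega⟩, LinearMap.id, fun v => ?_⟩
    funext j
    simp only [insertArg, update_apply, Fin.ext_iff, Fin.lt_def, LinearMap.id_apply]
    split_ifs <;> first | rfl | omega | (congr 1; funext r; rw [if_neg (by omega)])
  · by_cases h2 : (l : ℕ) < i + m
    · refine ⟨i, g.toLinearMap (fun r => x ⟨i + r, by have := r.isLt; omega⟩)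
        ⟨l - i, by omega⟩, fun v => ?_⟩
      funext j
      by_cases hj : j = i
      · subst hj
        simp only [insertArg, update_apply, lt_irrefl, dite_false, dite_true, if_true,
          MultilinearMap.toLinearMap_apply]
        congr 1
        funext r
        simp only [update_apply, Fin.ext_iff]
        split_ifs <;> first | rfl | omega
      · have hj' : (j : ℕ) ≠ i := fun e => hj (Fin.ext e)
        have hjn := j.isLt
        simp only [insertArg, update_apply, Fin.ext_iff, Fin.lt_def, hj', dite_false, if_false]
        split_ifs <;> first | rfl | omega
    · refine ⟨⟨l + 1 - m, by omega⟩, LinearMap.id, fun v => ?_⟩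
      funext j
      have hjn := j.isLt
      simp only [insertArg, update_apply, Fin.ext_iff, Fin.lt_def, LinearMap.id_apply]
      split_ifs <;> first | rfl | omega | (congr 1; funext r; rw [if_neg (by omega)])

/-- The partial composition `f ∘ᵢ g`. -/
def circAt {n m k : ℕ} (h : k + 1 = n + m) (f : Cochain K A n) (g : Cochain K A m) (i : Fin n) :
    Cochain K A k :=
  f.pull (insertArg h g i) (insertArg_update h g i)

/-- `f ∘ g = ∑ᵢ (-1)^{i (m-1)} f ∘ᵢ g`, with `i` counted from `0`; the exponent is written with
`m + 1`, which has the parity of `m - 1`. It is `0` for `n = 0`. -/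
def circ {n m k : ℕ} (h : k + 1 = n + m) (f : Cochain K A n) (g : Cochain K A m) : Cochain K A k :=
  ∑ i : Fin n, (-1 : K) ^ ((i : ℕ) * (m + 1)) • circAt h f g i

/-- The Gerstenhaber bracket `[f, g] = f ∘ g - (-1)^{(n-1)(m-1)} g ∘ f` on cochains; the exponent
is written with `(n + 1) (m + 1)`, which has the same parity. -/
def bracket {n m k : ℕ} (h : k + 1 = n + m) (f : Cochain K A n) (g : Cochain K A m) :
    Cochain K A k :=
  circ h f g - (-1 : K) ^ ((n + 1) * (m + 1)) • circ (h.trans (add_comm n m)) g f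

/-- The linear endomorphism of `A` given by a `1`-cochain. -/
def Cochain.toEnd (D : Cochain K A 1) : Module.End K A where
  toFun a := D fun _ => a
  map_add' a b := by
    have h : ∀ v : A, update (fun _ : Fin 1 => (0 : A)) 0 v = fun _ => v := fun v => by
      funext i; simp [Subsingleton.elim i 0]
    have := D.map_update_add (fun _ => 0) 0 a b
    simpa only [h] using this
  map_smul' c a := by
    have h : ∀ v : A, update (fun _ : Fin 1 => (0 : A)) 0 v = fun _ => v := fun v => by
      funext i; simp [Subsingleton.elim i 0]
    have := D.map_update_smul (fun _ => 0) 0 c a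
    simpa only [h, RingHom.id_apply] using this

theorem bracket_one_apply {n : ℕ} (D : Cochain K A 1) (f : Cochain K A n) (x : Fin n → A) :
    bracket (add_comm n 1) D f x =
      D.toEnd (f x) - ∑ i : Fin n, f (update x i (D.toEnd (x i))) := by
  have h1 : circ (add_comm n 1) D f x = D.toEnd (f x) := by
    simp only [circ, Finset.univ_unique, Fin.default_eq_zero, Finset.sum_singleton, Fin.val_zero,
      zero_mul, pow_zero, one_smul]
    change D _ = D _
    congr 1
    funext j
    simp [insertArg, Subsingleton.elim j 0]
  have h2 : circ ((add_comm n 1).trans (add_comm 1 n)) f D x =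
      ∑ i : Fin n, f (update x i (D.toEnd (x i))) := by
    simp only [circ, sum_apply, smul_apply]
    refine Finset.sum_congr rfl fun i _ => ?_
    rw [pow_mul', (by norm_num : (-1 : K) ^ (1 + 1) = 1), one_pow, one_smul]
    change f _ = f _
    congr 1
    funext j
    by_cases hj : j = i
    · subst hj
      simp only [insertArg, lt_irrefl, dite_false, dite_true, update_self]
      change D _ = D _
      congr 1
      funext l
      congr 1
      ext
      simp [Subsingleton.elim l 0]
    · simp only [insertArg, hj, dite_false, update_of_ne hj]
      split_ifs <;> rfl
  rw [bracket, sub_apply, smul_apply, h1, h2, pow_mul,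
    (by norm_num : (-1 : K) ^ (1 + 1) = 1), one_pow, one_smul]

/-- The Gerstenhaber bracket with cochains of degree one, as a bilinear map. -/
def bracketOne (K A : Type*) [CommRing K] [Ring A] [Algebra K A] (n : ℕ) :
    Cochain K A 1 →ₗ[K] Module.End K (Cochain K A n) :=
  LinearMap.mk₂ K (fun D f => bracket (add_comm n 1) D f)
    (by
      intro D E f
      ext x
      simp only [bracket_one_apply, add_apply, Cochain.toEnd, LinearMap.coe_mk,
        AddHom.coe_mk, MultilinearMap.map_update_add, Finset.sum_add_distrib]
      abel)
    (by
      intro c D f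
      ext x
      simp only [bracket_one_apply, smul_apply, Cochain.toEnd, LinearMap.coe_mk,
        AddHom.coe_mk, MultilinearMap.map_update_smul, smul_sub, Finset.smul_sum])
    (by
      intro D f g
      ext x
      simp only [bracket_one_apply, add_apply, map_add, Finset.sum_add_distrib]
      abel)
    (by
      intro c D f
      ext x
      simp only [bracket_one_apply, smul_apply, map_smul, smul_sub,
        Finset.smul_sum])

theorem bracketOne_apply {n : ℕ} (D : Cochain K A 1) (f : Cochain K A n) (x : Fin n → A) :
    bracketOne K A n D f x =
      D.toEnd (f x) - ∑ i : Fin n, f (update x i (D.toEnd (x i))) :=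
  bracket_one_apply D f x

theorem toEnd_bracketOne (D E : Cochain K A 1) (a : A) :
    (bracketOne K A 1 D E).toEnd a = D.toEnd (E.toEnd a) - E.toEnd (D.toEnd a) := by
  change bracketOne K A 1 D E (fun _ => a) = _
  rw [bracketOne_apply]
  simp only [Finset.univ_unique, Fin.default_eq_zero, Finset.sum_singleton]
  congr 1
  change E _ = E _
  congr 1
  funext i
  simp [Subsingleton.elim i 0]

theorem Cochain.toEnd_injective : Injective (Cochain.toEnd (K := K) (A := A)) := by
  intro D E h
  ext x
  have := LinearMap.congr_fun h (x 0)
  have hx : x = fun _ => x 0 := by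
    funext i; rw [Subsingleton.elim i 0]
  rw [hx]
  exact this

theorem bracketOne_jacobi {n : ℕ} (D E : Cochain K A 1) (f : Cochain K A n) :
    bracketOne K A n (bracketOne K A 1 D E) f =
      bracketOne K A n D (bracketOne K A n E f) - bracketOne K A n E (bracketOne K A n D f) := by
  ext x
  have key : ∀ P Q : Module.End K A,
      ∑ i : Fin n, ∑ j : Fin n, f (update (update x i (P (x i))) j (Q (update x i (P (x i)) j))) =
        ∑ i : Fin n, f (update x i (Q (P (x i)))) +
        ∑ i : Fin n, ∑ j : Fin n, if j = i then 0 else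
          f (update (update x i (P (x i))) j (Q (x j))) := by
    intro P Q
    rw [← Finset.sum_add_distrib]
    refine Finset.sum_congr rfl fun i _ => ?_
    rw [← Finset.sum_erase_add _ _ (Finset.mem_univ i),
      ← Finset.sum_erase_add _ (fun j => if j = i then 0 else
          f (update (update x i (P (x i))) j (Q (x j)))) (Finset.mem_univ i)]
    simp only [update_self, update_idem, if_true, add_zero]
    rw [add_comm]
    congr 1
    refine Finset.sum_congr rfl fun j hj => ?_
    have hj' : j ≠ i := Finset.ne_of_mem_erase hj
    rw [if_neg hj', update_of_ne hj']
  have comm : ∀ P Q : Module.End K A,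
      (∑ i : Fin n, ∑ j : Fin n, if j = i then 0 else
          f (update (update x i (P (x i))) j (Q (x j)))) =
      ∑ i : Fin n, ∑ j : Fin n, if j = i then 0 else
          f (update (update x i (Q (x i))) j (P (x j))) := by
    intro P Q
    rw [Finset.sum_comm]
    refine Finset.sum_congr rfl fun i _ => Finset.sum_congr rfl fun j _ => ?_
    by_cases h : i = j
    · simp [h]
    · rw [if_neg h, if_neg (Ne.symm h), update_comm h]
  simp only [bracketOne_apply, sub_apply, toEnd_bracketOne, map_sub, map_sum,
    MultilinearMap.map_update_sub, Finset.sum_sub_distrib, key]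
  rw [comm D.toEnd E.toEnd]
  abel

theorem mem_cocycles_one_iff {D : Cochain K A 1} :
    D ∈ cocycles K A 1 ↔ ∀ a b : A, D.toEnd (a * b) = a * D.toEnd b + D.toEnd a * b := by
  have key : ∀ x : Fin 2 → A, delta K A 1 D x =
      x 0 * D.toEnd (x 1) - D.toEnd (x 0 * x 1) + D.toEnd (x 0) * x 1 := by
    intro x
    have e1 : (Fin.tail x : Fin 1 → A) = fun _ => x 1 := by
      funext i; rw [Subsingleton.elim i 0]; rfl
    have e2 : (Fin.init x : Fin 1 → A) = fun _ => x 0 := by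
      funext i; rw [Subsingleton.elim i 0]; rfl
    have e3 : (Fin.contractNth (Fin.castSucc (0 : Fin 1)) (· * ·) x : Fin 1 → A) =
        fun _ => x 0 * x 1 := by
      funext i; rw [Subsingleton.elim i 0]; rfl
    rw [delta_apply]
    simp only [Finset.univ_unique, Fin.default_eq_zero, Finset.sum_singleton]
    rw [e1, e2, e3]
    simp [Cochain.toEnd, sub_eq_add_neg]
  rw [cocycles, LinearMap.mem_ker]
  constructor
  · intro h a b
    have h1 := key ![a, b]
    rw [h] at h1
    simp only [zero_apply, Matrix.cons_val_zero, Matrix.cons_val_one] at h1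
    rw [eq_comm, ← sub_eq_zero, h1]
    abel
  · intro h
    ext x
    rw [key, h]
    simp

theorem delta_bracketOne {n : ℕ} {D : Cochain K A 1} (hD : D ∈ cocycles K A 1)
    (f : Cochain K A n) :
    delta K A n (bracketOne K A n D f) = bracketOne K A (n + 1) D (delta K A n f) := by
  rw [mem_cocycles_one_iff] at hD
  ext x
  have hc : ∀ i : Fin n,
      ∑ l : Fin (n + 1), f (Fin.contractNth i.castSucc (· * ·) (update x l (D.toEnd (x l)))) =
      ∑ j : Fin n, f (update (Fin.contractNth i.castSucc (· * ·) x) j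
        (D.toEnd (Fin.contractNth i.castSucc (· * ·) x j))) := by
    intro i
    have hi : Fin.contractNth i.castSucc (· * ·) x i = x i.castSucc * x i.succ :=
      Fin.contractNth_apply_of_eq _ _ _ _ rfl
    rw [Fin.sum_univ_succAbove _ i.castSucc, ← Finset.add_sum_erase _ _ (Finset.mem_univ i),
      ← Finset.add_sum_erase (a := i) (f := fun j : Fin n => f (update
        (Fin.contractNth i.castSucc (· * ·) x) j
        (D.toEnd (Fin.contractNth i.castSucc (· * ·) x j)))) _ (Finset.mem_univ i),
      ← add_assoc]
    congr 1
    · rw [hi, hD, MultilinearMap.map_update_add, add_comm]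
      congr 2
      · funext j
        by_cases hj : j = i
        · subst hj
          rw [Fin.succAbove_castSucc_self]
          simp [Fin.contractNth, Fin.ext_iff]
        · have hj' : (j : ℕ) ≠ i := fun e => hj (Fin.ext e)
          simp only [Fin.contractNth, update_apply, Fin.ext_iff, Fin.val_castSucc, Fin.val_succ,
            Fin.succAbove_castSucc_self]
          split_ifs <;> first | rfl | omega
      · funext j
        by_cases hj : j = i
        · subst hj
          simp [Fin.contractNth, Fin.ext_iff]
        · have hj' : (j : ℕ) ≠ i := fun e => hj (Fin.ext e)
          simp only [Fin.contractNth, update_apply, Fin.ext_iff, Fin.val_castSucc, Fin.val_succ]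
          split_ifs <;> first | rfl | omega
    · refine Finset.sum_congr rfl fun j hj => ?_
      have hji : j ≠ i := Finset.ne_of_mem_erase hj
      have hj' : (j : ℕ) ≠ i := fun e => hji (Fin.ext e)
      congr 1
      rw [Fin.contractNth_apply_of_ne _ _ _ _ (by simpa using hj'.symm)]
      funext r
      rcases lt_or_gt_of_ne hj' with h | h
      · rw [Fin.succAbove_of_castSucc_lt _ _ (Fin.castSucc_lt_castSucc_iff.2 (Fin.lt_def.2 h))]
        simp only [Fin.contractNth, update_apply, Fin.ext_iff, Fin.val_castSucc, Fin.val_succ]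
        split_ifs <;> first | rfl | omega
      · rw [Fin.succAbove_of_le_castSucc _ _ (Fin.castSucc_le_castSucc_iff.2 (Fin.le_def.2 h.le))]
        simp only [Fin.contractNth, update_apply, Fin.ext_iff, Fin.val_castSucc, Fin.val_succ]
        split_ifs <;> first | rfl | omega
  have hl : ∑ l : Fin (n + 1), update x l (D.toEnd (x l)) 0 *
      f (Fin.tail (update x l (D.toEnd (x l)))) = D.toEnd (x 0) * f (Fin.tail x) +
        x 0 * ∑ j : Fin n, f (update (Fin.tail x) j (D.toEnd (Fin.tail x j))) := by
    rw [Fin.sum_univ_succ, Finset.mul_sum]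
    simp only [update_self, Fin.tail_update_zero, Fin.tail_update_succ]
    congr 1
  have hr : ∑ l : Fin (n + 1), f (Fin.init (update x l (D.toEnd (x l)))) *
      update x l (D.toEnd (x l)) (Fin.last n) =
        (∑ j : Fin n, f (update (Fin.init x) j (D.toEnd (Fin.init x j)))) * x (Fin.last n) +
        f (Fin.init x) * D.toEnd (x (Fin.last n)) := by
    rw [Fin.sum_univ_castSucc, Finset.sum_mul]
    simp only [update_self, Fin.init_update_last, Fin.init_update_castSucc]
    congr 1
    refine Finset.sum_congr rfl fun j _ => ?_
    rw [update_of_ne (Fin.castSucc_lt_last j).ne']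
    rfl
  rw [bracketOne_apply]
  simp only [delta_apply, bracketOne_apply, Finset.sum_add_distrib, ← Finset.smul_sum, hl, hr]
  rw [Finset.sum_comm]
  simp only [← Finset.smul_sum, hc, map_add, map_sum, map_smul, hD, smul_sub,
    Finset.sum_sub_distrib, mul_sub, sub_mul, smul_add]
  abel

theorem bracketOne_mem_cocycles {n : ℕ} {D : Cochain K A 1} (hD : D ∈ cocycles K A 1)
    {f : Cochain K A n} (hf : f ∈ cocycles K A n) :
    bracketOne K A n D f ∈ cocycles K A n := by
  have hf' : delta K A n f = 0 := hf
  change delta K A n _ = 0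
  rw [delta_bracketOne hD, hf', map_zero]

theorem bracketOne_mem_coboundaries {n : ℕ} {D : Cochain K A 1} (hD : D ∈ cocycles K A 1)
    {f : Cochain K A n} (hf : f ∈ coboundaries K A n) :
    bracketOne K A n D f ∈ coboundaries K A n := by
  cases n with
  | zero =>
    have hf' : f = 0 := hf
    rw [hf', map_zero]
    exact Submodule.zero_mem _
  | succ n =>
    obtain ⟨e, rfl⟩ := hf
    exact ⟨bracketOne K A n D e, delta_bracketOne hD e⟩

/-- The Gerstenhaber bracket `Z¹ × Zⁿ → Zⁿ` on cocycles. -/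
def bracketCocycles (K A : Type*) [CommRing K] [Ring A] [Algebra K A] (n : ℕ) :
    cocycles K A 1 →ₗ[K] Module.End K (cocycles K A n) :=
  LinearMap.mk₂ K (fun D f => ⟨bracketOne K A n D f, bracketOne_mem_cocycles D.2 f.2⟩)
    (fun D E f => Subtype.ext (by simp))
    (fun c D f => Subtype.ext (by simp))
    (fun D f g => Subtype.ext (by simp))
    (fun c D f => Subtype.ext (by simp))

/-- The Gerstenhaber bracket `Z¹ × HHⁿ → HHⁿ`. -/
def bracketQuot (K A : Type*) [CommRing K] [Ring A] [Algebra K A] (n : ℕ) :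
    cocycles K A 1 →ₗ[K] Module.End K (HH K A n) where
  toFun D := HH.lift (HH.mk K A n ∘ₗ bracketCocycles K A n D)
    (fun _ hf => HH.mk_eq_zero.2 (bracketOne_mem_coboundaries D.2 hf))
  map_add' D E := by
    ext ξ
    obtain ⟨f, rfl⟩ := HH.mk_surjective n ξ
    simp [HH.lift_mk]
  map_smul' c D := by
    ext ξ
    obtain ⟨f, rfl⟩ := HH.mk_surjective n ξ
    simp [HH.lift_mk]

end General

section Commutative

variable {K A : Type*} [CommRing K] [CommRing A] [Algebra K A]

theorem coboundaries_one : coboundaries K A 1 = ⊥ := by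
  rw [eq_bot_iff]
  rintro _ ⟨f, rfl⟩
  change delta K A 0 f = 0
  ext x
  have e : (Fin.init x : Fin 0 → A) = Fin.tail x := Subsingleton.elim _ _
  have e' : (Fin.last 0 : Fin 1) = 0 := rfl
  rw [delta_apply, e, e']
  simp [mul_comm]

/-- The Gerstenhaber bracket `HH¹ × HHⁿ → HHⁿ` of a commutative algebra. -/
def bracketHH (K A : Type*) [CommRing K] [CommRing A] [Algebra K A] (n : ℕ) :
    HH K A 1 →ₗ[K] Module.End K (HH K A n) :=
  HH.lift (bracketQuot K A n) (by
    intro D hD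
    rw [coboundaries_one, Submodule.mem_bot] at hD
    have : D = 0 := Subtype.ext hD
    rw [this, map_zero])

theorem bracketHH_mk {n : ℕ} (D : cocycles K A 1) (f : cocycles K A n) :
    bracketHH K A n (HH.mk K A 1 D) (HH.mk K A n f) = HH.mk K A n (bracketCocycles K A n D f) :=
  rfl

theorem bracketCocycles_coe {n : ℕ} (D : cocycles K A 1) (f : cocycles K A n) :
    (bracketCocycles K A n D f : Cochain K A n) =
      bracket (add_comm n 1) (D : Cochain K A 1) (f : Cochain K A n) :=
  rfl

theorem bracket_leibniz {n : ℕ} (D E : HH K A 1) (ξ : HH K A n) :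
    bracketHH K A n D (bracketHH K A n E ξ) =
      bracketHH K A n (bracketHH K A 1 D E) ξ + bracketHH K A n E (bracketHH K A n D ξ) := by
  obtain ⟨D, rfl⟩ := HH.mk_surjective _ D
  obtain ⟨E, rfl⟩ := HH.mk_surjective _ E
  obtain ⟨f, rfl⟩ := HH.mk_surjective _ ξ
  simp only [bracketHH_mk, ← map_add]
  congr 1
  apply Subtype.ext
  change bracketOne K A n D (bracketOne K A n E f) =
    bracketOne K A n (bracketOne K A 1 D E) f + bracketOne K A n E (bracketOne K A n D f)
  rw [bracketOne_jacobi]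
  abel

/-- `HH¹(A)` with the Gerstenhaber bracket is a Lie ring. -/
instance : LieRing (HH K A 1) where
  bracket D E := bracketHH K A 1 D E
  add_lie D E ξ := by
    change bracketHH K A 1 _ _ = bracketHH K A 1 _ _ + bracketHH K A 1 _ _
    simp
  lie_add D ξ η := by
    change bracketHH K A 1 _ _ = bracketHH K A 1 _ _ + bracketHH K A 1 _ _
    simp
  lie_self D := by
    obtain ⟨D, rfl⟩ := HH.mk_surjective _ D
    change bracketHH K A 1 _ _ = 0
    rw [bracketHH_mk]
    have : bracketCocycles K A 1 D D = 0 := by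
      apply Subtype.ext
      apply Cochain.toEnd_injective
      ext a
      change (bracketOne K A 1 D D).toEnd a = 0
      rw [toEnd_bracketOne, sub_self]
    rw [this, map_zero]
  leibniz_lie D E ξ := bracket_leibniz D E ξ

/-- `HH¹(A)` with the Gerstenhaber bracket is a Lie algebra. -/
instance : LieAlgebra K (HH K A 1) where
  lie_smul c D ξ := map_smul (bracketHH K A 1 D) c ξ

/-- `HHⁿ(A)` is a Lie module over `HH¹(A)` by the Gerstenhaber bracket. -/
instance (n : ℕ) : LieRingModule (HH K A 1) (HH K A n) where
  bracket D ξ := bracketHH K A n D ξ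
  add_lie D E ξ := by
    simp
  lie_add D ξ η := by
    simp
  leibniz_lie D E ξ := bracket_leibniz D E ξ

instance (n : ℕ) : LieModule K (HH K A 1) (HH K A n) where
  smul_lie c D ξ := by
    change bracketHH K A n _ _ = c • bracketHH K A n _ _
    simp
  lie_smul c D ξ := map_smul (bracketHH K A n D) c ξ

theorem lie_def {n : ℕ} (D : HH K A 1) (ξ : HH K A n) : ⁅D, ξ⁆ = bracketHH K A n D ξ :=
  rfl

end Commutative

end Hochschild

/-! ### Inhomogeneous group cochains with trivial coefficients -/

namespace GroupCochain

open Finset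

/-! Since `KG` is commutative, multiplying `f(y₁, …, yₙ)` by `(y₁ ⋯ yₙ)⁻¹` turns the Hochschild
complex of `KG` into the complex of group cochains with values in `KG` and trivial action
(`toGroup_delta`). So `HHⁿ(KG)` is the cohomology of a cyclic group with trivial coefficients that
are killed by `|G|`, and this is one copy of `KG` in every degree.

The identification is explicit. Fix a generator `g` and discrete logarithms. The carry in the
addition of logarithms is a 2-cocycle, and cup product with it raises the degree by two. In the
other direction, `φ ↦ ∑ z, φ(g, z, ·)` lowers the degree by two. The second map is a left inverse of
the first on cochains, and `eq_d_homotopy_add_cupCarry` shows that it is a right inverse up to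
coboundaries. Iterating it down to degree 0 or 1 gives the isomorphism `ev`. The cocycles `base n`,
obtained from 1 and from the logarithm by cup products with the carry, have `ev` equal to 1; hence
every class is `b • [c]` with `b` in `KG` and `c` the Hochschild cocycle of `base n`.

Let `E` be the Euler derivation `y ↦ log y • y`. Every derivation is `a • E`, and `[aE, bE] = (a
E(b) - b E(a)) E`. Because `[D, b • c] = D(b) • c + b • [D, c]`, the module structure is determined
by the brackets `[aE, c]`, and by linearity `a` may be a group element `h`. The values of `base n`
are integers, so `E` kills them, and `[hE, c]` becomes `h` times `translationDefect L h (base n)`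
(`toGroup_bracketOne`). The defect is compatible with the periodicity
(`lower_translationDefect_cupCarry`), so only degrees 0 and 1 need computing: its evaluation is 0 in
even degree and `-log h` in odd degree. Thus `[aE, c]` evaluates to 0 or to `-E(a)`, and `aE` acts
on `b` by `a E(b)` in even degree, by `a E(b) - b E(a)` in odd degree. These are the standard and
the adjoint action. -/

/-- The inhomogeneous differential on functions `Gⁿ → M`, for the trivial action on `M`. -/
def d {G M : Type*} [Mul G] [AddCommGroup M] {n : ℕ} (φ : (Fin n → G) → M)
    (y : Fin (n + 1) → G) : M :=
  φ (Fin.tail y) +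
    ∑ i : Fin n, (-1 : ℤ) ^ ((i : ℕ) + 1) • φ (Fin.contractNth i.castSucc (· * ·) y) +
    (-1 : ℤ) ^ (n + 1) • φ (Fin.init y)

/-- The cochain `φ(x, ·)`. -/
def slice {G M : Type*} {n : ℕ} (φ : (Fin (n + 1) → G) → M) (x : G) : (Fin n → G) → M :=
  fun y => φ (Fin.cons x y)

theorem exists_cons_cons {G : Type*} {n : ℕ} (y : Fin (n + 2) → G) :
    ∃ a b w, y = Fin.cons a (Fin.cons b w) :=
  ⟨y 0, y 1, Fin.tail (Fin.tail y), by
    rw [← Fin.cons_self_tail y]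
    congr 1
    rw [← Fin.cons_self_tail (Fin.tail y)]
    rfl⟩

section Differential

variable {G M : Type*} [AddCommGroup M]

theorem contractNth_zero_cons [Mul G] {n : ℕ} (x : G) (y : Fin (n + 1) → G) :
    Fin.contractNth (0 : Fin (n + 1)).castSucc (· * ·) (Fin.cons x y : Fin (n + 2) → G) =
      Fin.cons (x * y 0) (Fin.tail y) := by
  funext j
  induction j using Fin.cases with
  | zero => simp [Fin.contractNth]
  | succ j => simp [Fin.contractNth, Fin.tail]

theorem contractNth_succ_cons [Mul G] {n : ℕ} (i : Fin n) (x : G) (y : Fin (n + 1) → G) :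
    Fin.contractNth i.succ.castSucc (· * ·) (Fin.cons x y : Fin (n + 2) → G) =
      Fin.cons x (Fin.contractNth i.castSucc (· * ·) y) := by
  funext j
  induction j using Fin.cases with
  | zero => simp [Fin.contractNth]
  | succ j => simp [Fin.contractNth]

/-- The differential, one argument at a time. -/
theorem d_cons [Mul G] {n : ℕ} (φ : (Fin (n + 1) → G) → M) (x : G) (y : Fin (n + 1) → G) :
    d φ (Fin.cons x y) = φ y - φ (Fin.cons (x * y 0) (Fin.tail y)) + φ (Fin.cons x (Fin.tail y)) -
      d (slice φ x) y := by
  have hinit : (Fin.init (Fin.cons x y : Fin (n + 2) → G) : Fin (n + 1) → G) =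
      Fin.cons x (Fin.init y) := by
    funext j
    induction j using Fin.cases with
    | zero => rfl
    | succ j => rfl
  have htail : (Fin.tail (Fin.cons x y : Fin (n + 2) → G) : Fin (n + 1) → G) = y :=
    Fin.tail_cons _ _
  simp only [d, slice]
  rw [htail, hinit, Fin.sum_univ_succ, contractNth_zero_cons]
  simp only [contractNth_succ_cons, Fin.val_zero, Fin.val_succ, pow_succ, mul_neg, mul_one,
    neg_neg, neg_smul, sum_neg_distrib, pow_zero, one_smul]
  abel

theorem d_zero_degree [Mul G] (φ : (Fin 0 → G) → M) (y : Fin 1 → G) : d φ y = 0 := by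
  have : (Fin.init y : Fin 0 → G) = Fin.tail y := Subsingleton.elim _ _
  simp [d, this]

theorem d_sub [Mul G] {n : ℕ} (φ ψ : (Fin n → G) → M) : d (φ - ψ) = d φ - d ψ := by
  funext y
  simp only [d, Pi.sub_apply, smul_sub, sum_sub_distrib]
  abel

theorem d_zero [Mul G] {n : ℕ} : d (0 : (Fin n → G) → M) = 0 := by
  rw [← sub_self (0 : (Fin n → G) → M), d_sub, sub_self]

theorem d_sum [Mul G] {n : ℕ} {ι : Type*} (s : Finset ι) (φ : ι → (Fin n → G) → M) :
    d (fun y => ∑ i ∈ s, φ i y) = fun y => ∑ i ∈ s, d (φ i) y := by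
  funext y
  simp only [d, smul_sum, sum_add_distrib]
  rw [sum_comm]

theorem d_smul [Mul G] {n : ℕ} {R : Type*} [Ring R] [Module R M] (c : R)
    (φ : (Fin n → G) → M) : d (fun y => c • φ y) = fun y => c • d φ y := by
  funext y
  simp only [d, smul_add, smul_sum, smul_comm c]

end Differential

/-! ### Discrete logarithms and carries in a cyclic group -/

/-- A generator of a cyclic group, with discrete logarithms in `{0, …, |G| - 1}`. -/
structure Log (G : Type*) [CommGroup G] where
  /-- The generator. -/
  gen : G
  /-- The exponent of an element. -/
  log : G → ℕ
  gen_pow_log : ∀ y, gen ^ log y = y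
  log_lt : ∀ y, log y < Nat.card G

namespace Log

variable {G : Type*} [CommGroup G]

theorem exists_of_generator [Finite G] {g : G} (hg : ∀ x : G, x ∈ Subgroup.zpowers g) :
    ∃ L : Log G, L.gen = g := by
  have h : ∀ y : G, ∃ m, g ^ m = y ∧ m < Nat.card G := by
    intro y
    obtain ⟨m, hm⟩ := (isOfFinOrder_of_finite g).mem_powers_iff_mem_zpowers.2 (hg y)
    refine ⟨m % Nat.card G, ?_, Nat.mod_lt _ Nat.card_pos⟩
    rw [← orderOf_eq_card_of_forall_mem_zpowers hg, pow_mod_orderOf]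
    exact hm
  choose t h1 h2 using h
  exact ⟨⟨g, t, h1, h2⟩, rfl⟩

variable (L : Log G)

theorem mem_zpowers (y : G) : y ∈ Subgroup.zpowers L.gen :=
  ⟨L.log y, by simpa using L.gen_pow_log y⟩

theorem orderOf_gen : orderOf L.gen = Nat.card G :=
  orderOf_eq_card_of_forall_mem_zpowers L.mem_zpowers

theorem log_gen_pow (m : ℕ) : L.log (L.gen ^ m) = m % Nat.card G := by
  have h := L.gen_pow_log (L.gen ^ m)
  rw [pow_eq_pow_iff_modEq, L.orderOf_gen] at h
  have := Nat.mod_eq_of_lt (L.log_lt (L.gen ^ m))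
  rw [← this]
  exact h

/-- The carry in the addition of discrete logarithms. -/
noncomputable def carry (y z : G) : ℕ :=
  if Nat.card G ≤ L.log y + L.log z then 1 else 0

theorem log_mul (y z : G) :
    L.log (y * z) + Nat.card G * L.carry y z = L.log y + L.log z := by
  have h : L.log (y * z) = (L.log y + L.log z) % Nat.card G := by
    rw [← L.log_gen_pow, pow_add, L.gen_pow_log, L.gen_pow_log]
  have hy := L.log_lt y
  have hz := L.log_lt z
  rw [h, carry]
  split_ifs with hc
  · rw [Nat.mod_eq_sub_mod hc, Nat.mod_eq_of_lt (by omega)]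
    omega
  · rw [Nat.mod_eq_of_lt (by omega)]
    omega

/-- Both sides, multiplied by `|G|`, equal `log x + log y + log z - log (x * y * z)`. -/
theorem carry_cocycle (x y z : G) :
    L.carry y z + L.carry x (y * z) = L.carry (x * y) z + L.carry x y := by
  have h1 := L.log_mul x y
  have h2 := L.log_mul y z
  have h3 := L.log_mul (x * y) z
  have h4 := L.log_mul x (y * z)
  rw [← mul_assoc] at h4
  have hN : 0 < Nat.card G := (Nat.zero_le _).trans_lt (L.log_lt x)
  apply Nat.eq_of_mul_eq_mul_left hN
  rw [mul_add, mul_add]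
  omega

theorem carry_gen (h1 : L.log L.gen = 1) (z : G) [Decidable (z = L.gen⁻¹)] :
    L.carry L.gen z = if z = L.gen⁻¹ then 1 else 0 := by
  have hz := L.log_lt z
  have h : z = L.gen⁻¹ ↔ Nat.card G ≤ 1 + L.log z := by
    have e : z * L.gen = L.gen ^ (L.log z + 1) := by rw [pow_succ, L.gen_pow_log]
    rw [eq_inv_iff_mul_eq_one, e, ← orderOf_dvd_iff_pow_eq_one, L.orderOf_gen]
    constructor
    · intro h
      exact (Nat.le_of_dvd (by omega) h).trans (by omega)
    · intro h
      exact ⟨1, by omega⟩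
  simp only [carry, h1, h]

/-- Sum `log_mul` over `z`: translation by `y` permutes the group, so the sums of `log (y * z)` and
`log z` cancel and a factor `|G|` divides out. -/
theorem sum_carry [Fintype G] (y : G) : ∑ z, L.carry y z = L.log y := by
  have h := sum_congr (rfl : (univ : Finset G) = univ) fun z _ => L.log_mul y z
  have e : ∑ z, L.log (y * z) = ∑ z, L.log z :=
    Fintype.sum_equiv (Equiv.mulLeft y) _ _ fun _ => rfl
  rw [sum_add_distrib, sum_add_distrib, e, ← mul_sum, sum_const, card_univ, smul_eq_mul,
    ← Nat.card_eq_fintype_card, add_comm] at h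
  exact Nat.eq_of_mul_eq_mul_left Nat.card_pos (Nat.add_right_cancel h)

/-- Carries are multiples of `|G|`, so the logarithm acts additively on a module killed by `|G|`. -/
theorem log_mul_smul {M : Type*} [AddCommMonoid M] (hN : ∀ m : M, Nat.card G • m = 0)
    (y z : G) (m : M) : L.log (y * z) • m = L.log y • m + L.log z • m := by
  rw [← add_smul, ← L.log_mul, add_smul, mul_smul, hN, add_zero]

theorem log_one : L.log 1 = 0 := by
  have := L.log_gen_pow 0
  simpa using this

/-- Sums over the group are sums over exponents. -/
theorem sum_range_pow [Fintype G] {M : Type*} [AddCommMonoid M] (ψ : G → M) :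
    ∑ j ∈ range (Nat.card G), ψ (L.gen ^ j) = ∑ z, ψ z := by
  refine sum_nbij' (fun j => L.gen ^ j) L.log ?_ ?_ ?_ ?_ ?_
  · simp
  · intro z _
    exact mem_range.2 (L.log_lt z)
  · intro j hj
    rw [L.log_gen_pow, Nat.mod_eq_of_lt (mem_range.1 hj)]
  · intro z _
    exact L.gen_pow_log z
  · simp

/-- The sum of `ψ` over the powers of the generator below `y`. -/
def partialSum {M : Type*} [AddCommMonoid M] (ψ : G → M) (y : G) : M :=
  ∑ j ∈ range (L.log y), ψ (L.gen ^ j)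

/-- The left side runs over the exponents below `log z + log y`. If they pass `|G|`, one full turn
around the group splits off, which is the carry term. -/
theorem partialSum_mul [Fintype G] {M : Type*} [AddCommMonoid M] (ψ : G → M) (y z : G) :
    L.partialSum ψ z + ∑ j ∈ range (L.log y), ψ (L.gen ^ j * z) =
      L.partialSum ψ (y * z) + L.carry y z • ∑ w, ψ w := by
  have h1 : L.partialSum ψ z + ∑ j ∈ range (L.log y), ψ (L.gen ^ j * z) =
      ∑ j ∈ range (L.log z + L.log y), ψ (L.gen ^ j) := by
    rw [sum_range_add, partialSum]
    congr 1
    refine sum_congr rfl fun j _ => ?_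
    rw [pow_add, L.gen_pow_log, mul_comm]
  rw [h1, add_comm (L.log z), ← L.log_mul y z, sum_range_add, partialSum]
  congr 1
  have h2 : ∀ j, ψ (L.gen ^ (L.log (y * z) + j)) = ψ (y * z * L.gen ^ j) := fun j => by
    rw [pow_add, L.gen_pow_log]
  simp only [h2]
  have h3 : L.carry y z = 0 ∨ L.carry y z = 1 := by
    rw [carry]; split_ifs <;> simp
  rcases h3 with h | h
  · simp [h]
  · rw [h, mul_one, one_smul, L.sum_range_pow (fun w => ψ (y * z * w))]
    exact Fintype.sum_equiv (Equiv.mulLeft (y * z)) _ _ fun _ => rfl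

end Log

/-! ### Periodicity -/

section Periodicity

variable {G M : Type*} [CommGroup G] [AddCommGroup M] (L : Log G)

/-- The periodicity map lowering the degree by two. -/
def lower [Fintype G] {n : ℕ} (φ : (Fin (n + 2) → G) → M) : (Fin n → G) → M :=
  fun y => ∑ z, φ (Fin.cons L.gen (Fin.cons z y))

/-- The cup product with the carry cocycle. -/
noncomputable def cupCarry {n : ℕ} (φ : (Fin n → G) → M) : (Fin (n + 2) → G) → M :=
  fun y => L.carry (y 0) (y 1) • φ (Fin.tail (Fin.tail y))

theorem cupCarry_cons {n : ℕ} (φ : (Fin n → G) → M) (x y : G) (w : Fin n → G) :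
    cupCarry L φ (Fin.cons x (Fin.cons y w)) = L.carry x y • φ w := by
  have h : (Fin.cons x (Fin.cons y w : Fin (n + 1) → G) : Fin (n + 2) → G) 1 = y := rfl
  simp [cupCarry, h]

theorem d_cons_cons {n : ℕ} (φ : (Fin (n + 2) → G) → M) (x y : G) (w : Fin (n + 1) → G) :
    d φ (Fin.cons x (Fin.cons y w)) =
      φ (Fin.cons y w) - φ (Fin.cons (x * y) w) +
        φ (Fin.cons x (Fin.cons (y * w 0) (Fin.tail w))) -
        φ (Fin.cons x (Fin.cons y (Fin.tail w))) + d (slice (slice φ x) y) w := by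
  rw [d_cons, d_cons]
  simp only [Fin.cons_zero, Fin.tail_cons, slice]
  abel

/-- The terms that involve the first two arguments cancel by `carry_cocycle`; no sign appears
because the carry has even degree. -/
theorem d_cupCarry {n : ℕ} (φ : (Fin n → G) → M) :
    d (cupCarry L φ) = cupCarry L (d φ) := by
  funext y
  obtain ⟨a, b, w, rfl⟩ := exists_cons_cons y
  have h1 : slice (slice (cupCarry L φ) a) b = fun w => (L.carry a b) • φ w := by
    funext w
    exact cupCarry_cons L φ a b w
  have h2 : (Fin.cons b w : Fin (n + 2) → G) = Fin.cons b (Fin.cons (w 0) (Fin.tail w)) := by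
    rw [Fin.cons_self_tail]
  have h3 : (Fin.cons (a * b) w : Fin (n + 2) → G) =
      Fin.cons (a * b) (Fin.cons (w 0) (Fin.tail w)) := by
    rw [Fin.cons_self_tail]
  have h4 : d (fun w => (L.carry a b) • φ w) w = (L.carry a b) • d φ w := by
    have := congrFun (d_smul ((L.carry a b : ℕ) : ℤ) φ) w
    simpa only [natCast_zsmul] using this
  have h5 := congrArg (fun k : ℕ => k • φ (Fin.tail w)) (L.carry_cocycle a b (w 0))
  simp only [add_smul] at h5
  rw [d_cons_cons, h1, h2, h3, h4]
  simp only [cupCarry_cons]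
  rw [Fin.cons_self_tail, add_eq_right, sub_add_eq_add_sub, h5]
  abel

variable [Fintype G]

/-- In the sum over `z`, only `z = gen⁻¹` produces a carry with `gen`. -/
theorem lower_cupCarry {n : ℕ} (φ : (Fin n → G) → M) (h1 : L.log L.gen = 1) :
    lower L (cupCarry L φ) = φ := by
  classical
  funext y
  simp [lower, cupCarry_cons, L.carry_gen h1, ite_smul]

/-- The terms of `d_cons_cons` outside the inner differential cancel in pairs after translating the
summation variable `z`. -/
theorem lower_d {n : ℕ} (φ : (Fin (n + 2) → G) → M) :
    lower L (d φ) = d (lower L φ) := by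
  funext w
  have hd : d (lower L φ) w = ∑ z, d (slice (slice φ L.gen) z) w :=
    congrFun (d_sum univ fun z => slice (slice φ L.gen) z) w
  have e1 : ∑ z, φ (Fin.cons (L.gen * z) w) = ∑ z, φ (Fin.cons z w) :=
    Fintype.sum_equiv (Equiv.mulLeft L.gen) _ _ fun _ => rfl
  have e2 : ∑ z, φ (Fin.cons L.gen (Fin.cons (z * w 0) (Fin.tail w))) =
      ∑ z, φ (Fin.cons L.gen (Fin.cons z (Fin.tail w))) :=
    Fintype.sum_equiv (Equiv.mulRight (w 0)) _ _ fun _ => rfl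
  rw [hd]
  simp only [lower, d_cons_cons, sum_add_distrib, sum_sub_distrib, e1, e2]
  abel

/-- Here the term `φ(gen)` does not depend on `z` and has no partner; it is summed `|G|` times,
which is why the coefficients must be killed by `|G|`. -/
theorem lower_d_one (hN : ∀ m : M, Nat.card G • m = 0) (φ : (Fin 1 → G) → M) :
    lower L (d φ) = 0 := by
  funext w
  have e : ∀ z, d φ (Fin.cons L.gen (Fin.cons z w)) =
      φ (Fin.cons z w) - φ (Fin.cons (L.gen * z) w) + φ (Fin.cons L.gen w) := by
    intro z
    rw [d_cons, d_zero_degree]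
    simp
  have e1 : ∑ z, φ (Fin.cons (L.gen * z) w) = ∑ z, φ (Fin.cons z w) :=
    Fintype.sum_equiv (Equiv.mulLeft L.gen) _ _ fun _ => rfl
  simp only [lower, e, sum_add_distrib, sum_sub_distrib, e1, sum_const, card_univ, sub_self,
    zero_add, Pi.zero_apply]
  rw [← Nat.card_eq_fintype_card, hN]

/-- The homotopy that deforms a cocycle into the cup product of the carry cocycle with its
image under the periodicity map. -/
noncomputable def homotopy {n : ℕ} (φ : (Fin (n + 2) → G) → M) : (Fin (n + 1) → G) → M :=
  fun y => slice φ 1 y -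
    L.partialSum (fun z => slice φ L.gen (Fin.cons z (Fin.tail y))) (y 0)

theorem eq_d_homotopy_add_cupCarry {n : ℕ} (φ : (Fin (n + 2) → G) → M) (hφ : d φ = 0) :
    φ = fun y => d (homotopy L φ) y + cupCarry L (lower L φ) y := by
  have hφ' : ∀ x (y : Fin (n + 2) → G), φ (Fin.cons (x * y 0) (Fin.tail y)) =
      φ y + φ (Fin.cons x (Fin.tail y)) - d (slice φ x) y := by
    intro x y
    have h := congrFun hφ (Fin.cons x y)
    rw [d_cons, Pi.zero_apply, sub_eq_zero, sub_add_eq_add_sub, sub_eq_iff_eq_add] at h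
    rw [h]
    abel
  set ψ := slice φ L.gen with hψ
  set v : (Fin (n + 1) → G) → M :=
    fun y => L.partialSum (fun z => ψ (Fin.cons z (Fin.tail y))) (y 0) with hv
  have hv' : ∀ z (w : Fin n → G), v (Fin.cons z w) =
      L.partialSum (fun z => ψ (Fin.cons z w)) z := by
    intro z w
    simp [hv]
  -- The cocycle condition at `(gen, gen ^ m, w)` expresses the step from `gen ^ m` to `gen ^ (m +
  -- 1)` in the first argument; these steps telescope.
  have hpow : ∀ m (w : Fin (n + 1) → G), φ (Fin.cons (L.gen ^ m) w) =
      φ (Fin.cons 1 w) + m • ψ w - ∑ j ∈ range m, d ψ (Fin.cons (L.gen ^ j) w) := by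
    intro m w
    induction m with
    | zero => simp
    | succ m ih =>
      have h := hφ' L.gen (Fin.cons (L.gen ^ m) w)
      rw [Fin.cons_zero, Fin.tail_cons, ← pow_succ'] at h
      rw [h, ih, sum_range_succ, succ_nsmul, hψ]
      simp only [slice]
      abel
  -- For first argument 1 the two occurrences of `φ y` in the cocycle condition cancel.
  have hone : ∀ y : Fin (n + 2) → G, φ (Fin.cons 1 (Fin.tail y)) = d (slice φ 1) y := by
    intro y
    have h := hφ' 1 y
    rw [one_mul, Fin.cons_self_tail] at h
    rw [← sub_eq_zero]
    calc _ = φ y + φ (Fin.cons 1 (Fin.tail y)) - d (slice φ 1) y - φ y := by abel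
      _ = 0 := by rw [← h, sub_self]
  have hhom : homotopy L φ = slice φ 1 - v := rfl
  funext y
  obtain ⟨a, b, w, rfl⟩ := exists_cons_cons y
  have hslice : d (slice v a) (Fin.cons b w) =
      ∑ j ∈ range (L.log a), d (slice ψ (L.gen ^ j)) (Fin.cons b w) := by
    have : slice v a = fun y => ∑ j ∈ range (L.log a), slice ψ (L.gen ^ j) y := by
      funext y
      exact hv' a y
    rw [this, d_sum]
  -- The multiple `L.log a • ψ` cancels the one in `hpow`; the other terms are those of `d v`, up to
  -- the translated partial sum that `hmul` converts into a carry.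
  have hsum : ∑ j ∈ range (L.log a), d ψ (Fin.cons (L.gen ^ j) (Fin.cons b w)) =
      L.log a • ψ (Fin.cons b w) - ∑ j ∈ range (L.log a), ψ (Fin.cons (L.gen ^ j * b) w) +
        v (Fin.cons a w) - d (slice v a) (Fin.cons b w) := by
    simp only [d_cons, Fin.cons_zero, Fin.tail_cons, sum_add_distrib, sum_sub_distrib, hslice,
      sum_const, card_range, hv', Log.partialSum]
  have hdv : d v (Fin.cons a (Fin.cons b w)) = v (Fin.cons b w) - v (Fin.cons (a * b) w) +
      v (Fin.cons a w) - d (slice v a) (Fin.cons b w) := by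
    simp only [d_cons v, Fin.cons_zero, Fin.tail_cons]
  have hmul : v (Fin.cons b w) + ∑ j ∈ range (L.log a), ψ (Fin.cons (L.gen ^ j * b) w) =
      v (Fin.cons (a * b) w) + L.carry a b • lower L φ w := by
    rw [hv', hv']
    exact L.partialSum_mul (fun z => ψ (Fin.cons z w)) a b
  have h1 := hpow (L.log a) (Fin.cons b w)
  have h2 := hone (Fin.cons a (Fin.cons b w))
  rw [Fin.tail_cons] at h2
  rw [L.gen_pow_log, hsum, h2] at h1
  rw [h1, hhom, d_sub, cupCarry_cons, Pi.sub_apply, hdv, eq_sub_of_add_eq' hmul]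
  abel

end Periodicity

end GroupCochain

/-! ### Cohomology of a cyclic group with trivial coefficients -/

namespace GroupCochain

open Finset

section Base

variable {G : Type*} [CommGroup G] (L : Log G) (R : Type*) [Ring R]

/-- Cocycles that generate the cohomology. -/
noncomputable def base : (n : ℕ) → (Fin n → G) → R
  | 0 => 1
  | 1 => fun y => L.log (y 0)
  | n + 2 => cupCarry L (base n)

theorem d_base (hN : ∀ m : R, Nat.card G • m = 0) : (n : ℕ) → d (base L R n) = 0
  | 0 => funext fun y => d_zero_degree _ y
  | 1 => by
    funext y
    obtain ⟨a, b, w, rfl⟩ := exists_cons_cons y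
    have h := L.log_mul_smul hN a b 1
    simp only [nsmul_eq_mul, mul_one] at h
    rw [d_cons, d_zero_degree]
    simp [base, h]
  | n + 2 => by
    rw [base, d_cupCarry, d_base hN n]
    funext y
    simp [cupCarry]

end Base

variable {G M : Type*} [CommGroup G] [Fintype G] [AddCommGroup M] (L : Log G)

/-- The evaluation of cochains that identifies cohomology with the coefficients. -/
def ev : (n : ℕ) → ((Fin n → G) → M) → M
  | 0, φ => φ Fin.elim0
  | 1, φ => φ fun _ => L.gen
  | n + 2, φ => ev n (lower L φ)

theorem ev_add : (n : ℕ) → (φ ψ : (Fin n → G) → M) → ev L n (φ + ψ) = ev L n φ + ev L n ψ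
  | 0, _, _ => rfl
  | 1, _, _ => rfl
  | n + 2, φ, ψ => by
    have h : lower L (φ + ψ) = lower L φ + lower L ψ := by
      funext y
      simp [lower, sum_add_distrib]
    rw [ev, h, ev_add n]
    rfl

theorem ev_smul {R : Type*} [Monoid R] [DistribMulAction R M] (c : R) :
    (n : ℕ) → (φ : (Fin n → G) → M) → ev L n (c • φ) = c • ev L n φ
  | 0, _ => rfl
  | 1, _ => rfl
  | n + 2, φ => by
    have h : lower L (c • φ) = c • lower L φ := by
      funext y
      simp [lower, smul_sum]
    rw [ev, h, ev_smul c n]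
    rfl

theorem ev_zero (n : ℕ) : ev L n (0 : (Fin n → G) → M) = 0 := by
  have h := ev_add L n (0 : (Fin n → G) → M) 0
  rw [add_zero] at h
  exact left_eq_add.1 h

/-- Coboundaries, with none but zero in degree zero. -/
def IsCoboundary : {n : ℕ} → ((Fin n → G) → M) → Prop
  | 0, φ => φ = 0
  | _ + 1, φ => ∃ η, d η = φ

/-- Lowering commutes with `d` until the target degree is 1, where `d` itself is zero, or 2, where
`lower_d_one` applies. -/
theorem ev_d (hN : ∀ m : M, Nat.card G • m = 0) :
    (n : ℕ) → (φ : (Fin n → G) → M) → ev L (n + 1) (d φ) = 0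
  | 0, φ => d_zero_degree φ _
  | 1, φ => by
    rw [ev, lower_d_one L hN, ev_zero]
  | n + 2, φ => by
    rw [ev, lower_d, ev_d hN n]

/-- A 1-cocycle is a homomorphism, so it vanishes once it vanishes at the generator. In higher
degree the homotopy reduces `φ` to the cup product of the carry with `lower L φ`, and induction
applies. -/
theorem isCoboundary_of_ev_eq_zero : (n : ℕ) → (φ : (Fin n → G) → M) → d φ = 0 →
    ev L n φ = 0 → IsCoboundary φ
  | 0, φ, _, h => by
    funext y
    rw [Subsingleton.elim y Fin.elim0]
    exact h
  | 1, φ, hd, h => by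
    -- The differential from degree 0 to degree 1 is zero, so `φ` itself has to vanish.
    refine ⟨0, ?_⟩
    have hmul : ∀ x y : G, φ (fun _ => x * y) = φ (fun _ => y) + φ fun _ => x := by
      intro x y
      have e := congrFun hd (Fin.cons x fun _ => y)
      have hc : ∀ (z : G) (w : Fin 0 → G), (Fin.cons z w : Fin 1 → G) = fun _ => z := by
        intro z w
        funext i
        rw [Fin.fin_one_eq_zero i]
        rfl
      rw [d_cons, d_zero_degree, hc, hc, sub_zero, Pi.zero_apply, sub_add_eq_add_sub,
        sub_eq_zero] at e
      exact e.symm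
    have hpow : ∀ m : ℕ, φ (fun _ => L.gen ^ m) = 0 := by
      intro m
      induction m with
      | zero => simpa using hmul 1 1
      | succ m ih => rw [pow_succ, hmul, ih, add_zero]; exact h
    rw [d_zero]
    funext y
    have hy : y = fun _ => L.gen ^ L.log (y 0) := by
      funext i
      rw [L.gen_pow_log, Fin.fin_one_eq_zero i]
    rw [hy, hpow, Pi.zero_apply]
  | n + 2, φ, hd, h => by
    have hl : d (lower L φ) = 0 := by
      rw [← lower_d, hd]
      funext y
      simp [lower]
    have key := eq_d_homotopy_add_cupCarry L φ hd
    have ih := isCoboundary_of_ev_eq_zero n (lower L φ) hl h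
    obtain ⟨η, hη⟩ : ∃ η, d η = cupCarry L (lower L φ) := by
      cases n with
      | zero =>
        have h0 : lower L φ = 0 := ih
        refine ⟨0, ?_⟩
        rw [h0, d_zero]
        funext y
        simp [cupCarry]
      | succ n =>
        obtain ⟨η, hη⟩ := ih
        exact ⟨cupCarry L η, by rw [d_cupCarry, hη]⟩
    -- This is the sum of the homotopy and `η`, written so that `d_sub` and `d_zero` apply.
    refine ⟨homotopy L φ - (0 - η), ?_⟩
    rw [d_sub, d_sub, d_zero, zero_sub, sub_neg_eq_add, hη]
    exact key.symm

theorem ev_base (R : Type*) [Ring R] (h1 : L.log L.gen = 1) : (n : ℕ) → ev L n (base L R n) = 1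
  | 0 => rfl
  | 1 => by simp [ev, base, h1]
  | n + 2 => by rw [ev, base, lower_cupCarry L _ h1, ev_base R h1 n]

/-! ### Translating one argument of a cochain -/

/-- The failure of `φ` to be invariant under translation of one argument by `h`, weighted by
logarithms. -/
def translationDefect (h : G) {n : ℕ} (φ : (Fin n → G) → M) : (Fin n → G) → M :=
  fun y => ∑ l, L.log (y l) • (φ y - φ (Function.update y l (h * y l)))

/-- The two new arguments contribute `log gen + log gen⁻¹` and `-(log (h * gen) + log (h * gen)⁻¹)`
times `φ`. Both sums are multiples of `|G|` and act as zero. The old arguments contribute the defect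
of `φ`, with the total carry of `gen`, which is 1. -/
theorem lower_translationDefect_cupCarry (h1 : L.log L.gen = 1)
    (hN : ∀ m : M, Nat.card G • m = 0) (h : G) {n : ℕ} (φ : (Fin n → G) → M) :
    lower L (translationDefect L h (cupCarry L φ)) = translationDefect L h φ := by
  classical
  funext w
  -- The first difference comes from the argument `gen`, the second from `z`, and the last term from
  -- the arguments in `w`.
  have hz : ∀ z, translationDefect L h (cupCarry L φ) (Fin.cons L.gen (Fin.cons z w)) =
      (L.carry L.gen z • φ w - L.carry (h * L.gen) z • φ w) +
        (L.carry L.gen z • (L.log z • φ w) - L.carry L.gen (h * z) • (L.log z • φ w)) +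
        L.carry L.gen z • translationDefect L h φ w := by
    intro z
    simp only [translationDefect]
    rw [Fin.sum_univ_succ, Fin.sum_univ_succ, ← add_assoc]
    congr 1
    · congr 1
      · rw [Fin.cons_zero, Fin.update_cons_zero, cupCarry_cons, cupCarry_cons, h1, one_smul]
      · rw [Fin.cons_succ, ← Fin.cons_update, Fin.cons_zero, Fin.update_cons_zero,
          cupCarry_cons, cupCarry_cons, smul_sub, smul_comm (L.log z), smul_comm (L.log z)]
    · rw [smul_sum]
      refine sum_congr rfl fun l _ => ?_
      rw [Fin.cons_succ, ← Fin.cons_update, Fin.cons_succ, ← Fin.cons_update,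
        cupCarry_cons, cupCarry_cons, ← smul_sub, smul_comm]
  have hshift : ∀ ψ : G → M, ∑ z, L.carry L.gen (h * z) • ψ z = ψ (h * L.gen)⁻¹ := by
    intro ψ
    have e : ∀ z, h * z = L.gen⁻¹ ↔ z = (h * L.gen)⁻¹ := by
      intro z
      rw [mul_inv, eq_inv_mul_iff_mul_eq]
    simp only [L.carry_gen h1, ite_smul, one_smul, zero_smul, e]
    simp
  have hgen : ∀ ψ : G → M, ∑ z, L.carry L.gen z • ψ z = ψ L.gen⁻¹ := by
    intro ψ
    simp [L.carry_gen h1, ite_smul]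
  have hinv : ∀ y : G, L.log y • φ w + L.log y⁻¹ • φ w = 0 := by
    intro y
    rw [← L.log_mul_smul hN, mul_inv_cancel, L.log_one, zero_smul]
  simp only [lower, hz, sum_add_distrib, sum_sub_distrib, hshift, hgen]
  rw [← sum_smul, L.sum_carry]
  have a1 := hinv L.gen
  have a2 := hinv (h * L.gen)
  rw [h1, one_smul] at a1
  rw [add_eq_right, sub_add_sub_comm, a1, a2, sub_zero]

theorem ev_translationDefect_base_even (R : Type*) [Ring R] (h1 : L.log L.gen = 1)
    (hN : ∀ m : R, Nat.card G • m = 0) (h : G) (k : ℕ) :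
    ev L (2 * k) (translationDefect L h (base L R (2 * k))) = 0 := by
  induction k with
  | zero => simp [ev, translationDefect]
  | succ k ih =>
    change ev L (2 * k) (lower L (translationDefect L h (cupCarry L (base L R (2 * k))))) = 0
    rw [lower_translationDefect_cupCarry L h1 hN, ih]

/-- In degree 1 the defect of the logarithm at `gen` is `log gen - log (h * gen)`; periodicity
carries this value to all odd degrees. -/
theorem ev_translationDefect_base_odd (R : Type*) [Ring R] (h1 : L.log L.gen = 1)
    (hN : ∀ m : R, Nat.card G • m = 0) (h : G) (k : ℕ) :
    ev L (2 * k + 1) (translationDefect L h (base L R (2 * k + 1))) = -(L.log h : R) := by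
  induction k with
  | zero =>
    change ∑ l : Fin 1, _ = _
    have e := L.log_mul_smul hN h L.gen 1
    simp only [nsmul_eq_mul, mul_one] at e
    simp [base, h1, e]
  | succ k ih =>
    change ev L (2 * k + 1)
      (lower L (translationDefect L h (cupCarry L (base L R (2 * k + 1))))) = _
    rw [lower_translationDefect_cupCarry L h1 hN, ih]

end GroupCochain

/-! ### Derivations of the group algebra of a cyclic group -/

namespace GroupCochain

open Finset

theorem natCard_smul_eq_zero {K G M : Type*} [CommRing K] [AddCommGroup M] [Module K M]
    (hK : (Nat.card G : K) = 0) (m : M) : Nat.card G • m = 0 := by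
  rw [← Nat.cast_smul_eq_nsmul K, hK, zero_smul]

variable {K G : Type*} [CommRing K] [CommGroup G] (L : Log G)

theorem Log.cast_log_mul (hK : (Nat.card G : K) = 0) (y z : G) :
    (L.log (y * z) : K) = L.log y + L.log z := by
  have h := congrArg (Nat.cast (R := K)) (L.log_mul y z)
  push_cast at h
  rwa [hK, zero_mul, add_zero] at h

theorem Log.cast_log_prod (hK : (Nat.card G : K) = 0) {n : ℕ} (y : Fin n → G) :
    (L.log (∏ i, y i) : K) = ∑ i, (L.log (y i) : K) := by
  induction n with
  | zero => simp [L.log_one]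
  | succ n ih => rw [Fin.prod_univ_succ, L.cast_log_mul hK, ih, Fin.sum_univ_succ]

theorem basis_eq_of (y : G) : MonoidAlgebra.basis G K y = MonoidAlgebra.of K G y :=
  rfl

/-- The linear map that multiplies each group element by its logarithm. -/
noncomputable def eulerLinear : MonoidAlgebra K G →ₗ[K] MonoidAlgebra K G :=
  (MonoidAlgebra.basis G K).constr K fun y => (L.log y : K) • MonoidAlgebra.of K G y

theorem eulerLinear_of (y : G) :
    eulerLinear L (MonoidAlgebra.of K G y) = (L.log y : K) • MonoidAlgebra.of K G y :=
  (MonoidAlgebra.basis G K).constr_basis K _ y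

theorem eulerLinear_mul (hK : (Nat.card G : K) = 0) (a b : MonoidAlgebra K G) :
    eulerLinear L (a * b) = a * eulerLinear L b + b * eulerLinear L a := by
  have key : (LinearMap.mul K (MonoidAlgebra K G)).compr₂ (eulerLinear L) =
      (LinearMap.mul K (MonoidAlgebra K G)).compl₂ (eulerLinear L) +
        ((LinearMap.mul K (MonoidAlgebra K G)).compl₂ (eulerLinear L)).flip := by
    refine LinearMap.ext_basis (MonoidAlgebra.basis G K) (MonoidAlgebra.basis G K) ?_
    intro y z
    simp only [basis_eq_of, LinearMap.compr₂_apply, LinearMap.add_apply, LinearMap.compl₂_apply,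
      LinearMap.flip_apply, LinearMap.mul_apply', ← map_mul, eulerLinear_of, L.cast_log_mul hK,
      mul_smul_comm, mul_comm z y, add_smul]
    rw [add_comm]
  exact LinearMap.congr_fun₂ key a b

/-- The derivation of `KG` that multiplies each group element by its logarithm. -/
noncomputable def euler (hK : (Nat.card G : K) = 0) :
    Derivation K (MonoidAlgebra K G) (MonoidAlgebra K G) :=
  Derivation.mk' (eulerLinear L) (eulerLinear_mul L hK)

theorem euler_of (hK : (Nat.card G : K) = 0) (y : G) :
    euler L hK (MonoidAlgebra.of K G y) = (L.log y : K) • MonoidAlgebra.of K G y :=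
  eulerLinear_of L y

/-- The powers of `gen` span `KG`, so the Leibniz rule determines a derivation from its value at
`gen`. -/
theorem derivation_ext {D E : Derivation K (MonoidAlgebra K G) (MonoidAlgebra K G)}
    (h : D (MonoidAlgebra.of K G L.gen) = E (MonoidAlgebra.of K G L.gen)) : D = E := by
  have key : (D : MonoidAlgebra K G →ₗ[K] MonoidAlgebra K G) = E := by
    refine (MonoidAlgebra.basis G K).ext fun y => ?_
    have hb : MonoidAlgebra.basis G K y = MonoidAlgebra.of K G L.gen ^ L.log y := by
      rw [← map_pow, L.gen_pow_log, basis_eq_of]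
    rw [hb]
    change D _ = E _
    rw [D.leibniz_pow, E.leibniz_pow, h]
  ext1 a
  exact LinearMap.congr_fun key a

/-- Derivations of `KG` are the multiples of the Euler derivation. -/
noncomputable def derivationEquiv (hK : (Nat.card G : K) = 0) (h1 : L.log L.gen = 1) :
    MonoidAlgebra K G ≃ₗ[K] Derivation K (MonoidAlgebra K G) (MonoidAlgebra K G) where
  toFun a := a • euler L hK
  map_add' a b := add_smul a b _
  map_smul' c a := smul_assoc c a _
  -- The Euler derivation fixes `gen`, so the coefficient `a` of `a • E` is recovered from the value
  -- at `gen`.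
  invFun D := MonoidAlgebra.of K G L.gen⁻¹ * D (MonoidAlgebra.of K G L.gen)
  left_inv a := by
    beta_reduce
    rw [Derivation.smul_apply, euler_of, h1, Nat.cast_one, one_smul, smul_eq_mul, mul_left_comm,
      ← map_mul, inv_mul_cancel, map_one, mul_one]
  right_inv D := by
    apply derivation_ext L
    rw [Derivation.smul_apply, euler_of, h1, Nat.cast_one, one_smul, smul_eq_mul, mul_right_comm,
      ← map_mul, inv_mul_cancel, map_one, one_mul]

theorem derivationEquiv_apply (hK : (Nat.card G : K) = 0) (h1 : L.log L.gen = 1)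
    (a b : MonoidAlgebra K G) : derivationEquiv L hK h1 a b = a * euler L hK b :=
  rfl

theorem lie_derivationEquiv (hK : (Nat.card G : K) = 0) (h1 : L.log L.gen = 1)
    (a b : MonoidAlgebra K G) :
    ⁅derivationEquiv L hK h1 a, derivationEquiv L hK h1 b⁆ =
      derivationEquiv L hK h1 (a * euler L hK b - b * euler L hK a) := by
  ext1 c
  simp only [Derivation.commutator_apply, derivationEquiv_apply, Derivation.leibniz, smul_eq_mul]
  ring

/-- The basis of the Witt algebra. -/
theorem exists_witt_basis [Finite G] (hK : (Nat.card G : K) = 0) (h1 : L.log L.gen = 1) :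
    ∃ D : Module.Basis (ZMod (Nat.card G)) K
        (Derivation K (MonoidAlgebra K G) (MonoidAlgebra K G)),
      (∀ i, D i (MonoidAlgebra.of K G L.gen) = MonoidAlgebra.of K G (L.gen ^ (i.val + 1))) ∧
      ∀ i j, ⁅D i, D j⁆ = ((j.val : K) - (i.val : K)) • D (i + j) := by
  have : NeZero (Nat.card G) := ⟨Nat.card_pos.ne'⟩
  have hval : ∀ i : ZMod (Nat.card G), L.log (L.gen ^ i.val) = i.val := fun i => by
    rw [L.log_gen_pow, Nat.mod_eq_of_lt i.val_lt]
  let ε : G ≃ ZMod (Nat.card G) :=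
    { toFun := fun y => (L.log y : ZMod (Nat.card G))
      invFun := fun i => L.gen ^ i.val
      left_inv := fun y => by
        beta_reduce
        rw [ZMod.val_cast_of_lt (L.log_lt y), L.gen_pow_log]
      right_inv := fun i => by
        beta_reduce
        rw [hval, ZMod.natCast_val, ZMod.cast_id] }
  -- `D i` is `gen ^ i` times the Euler derivation.
  let D := ((MonoidAlgebra.basis G K).reindex ε).map (derivationEquiv L hK h1)
  have hD : ∀ i, D i = derivationEquiv L hK h1 (MonoidAlgebra.of K G (L.gen ^ i.val)) := by
    intro i
    simp only [D, Module.Basis.map_apply, Module.Basis.reindex_apply]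
    rfl
  refine ⟨D, ?_, ?_⟩
  · intro i
    rw [hD, derivationEquiv_apply, euler_of, h1, Nat.cast_one, one_smul, ← map_mul, pow_succ]
  · intro i j
    have hij : L.gen ^ (i + j).val = L.gen ^ i.val * L.gen ^ j.val := by
      rw [← pow_add, ZMod.val_add]
      conv_rhs => rw [← pow_mod_orderOf, L.orderOf_gen]
    rw [hD, hD, hD, lie_derivationEquiv, ← map_smul, euler_of, euler_of, hval, hval, hij, map_mul,
      mul_smul_comm, mul_smul_comm, mul_comm (MonoidAlgebra.of K G (L.gen ^ j.val)), ← sub_smul]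

end GroupCochain

/-! ### The first Hochschild cohomology of a commutative algebra -/

namespace Hochschild

open Finset

section Derivation

variable {K A : Type*} [CommRing K] [CommRing A] [Algebra K A]

/-- The derivation given by a `1`-cocycle. -/
def toDerivation (K A : Type*) [CommRing K] [CommRing A] [Algebra K A] :
    cocycles K A 1 →ₗ[K] Derivation K A A where
  toFun f := Derivation.mk' (f : Cochain K A 1).toEnd fun a b => by
    rw [mem_cocycles_one_iff.1 f.2, smul_eq_mul, smul_eq_mul, mul_comm _ b]
  map_add' _ _ := rfl
  map_smul' _ _ := rfl

/-- `HH¹` of a commutative algebra is the Lie algebra of derivations. -/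
noncomputable def derivationLieEquiv (K A : Type*) [CommRing K] [CommRing A] [Algebra K A] :
    HH K A 1 ≃ₗ⁅K⁆ Derivation K A A :=
  LieEquiv.ofBijective
    { HH.lift (toDerivation K A) (by
        intro f hf
        rw [coboundaries_one, Submodule.mem_bot] at hf
        have : f = 0 := Subtype.ext hf
        rw [this, map_zero]) with
      map_lie' := by
        intro D E
        obtain ⟨D, rfl⟩ := HH.mk_surjective _ D
        obtain ⟨E, rfl⟩ := HH.mk_surjective _ E
        ext1 a
        exact toEnd_bracketOne (D : Cochain K A 1) (E : Cochain K A 1) a }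
    (by
      constructor
      · refine (injective_iff_map_eq_zero _).2 fun D hD => ?_
        obtain ⟨D, rfl⟩ := HH.mk_surjective _ D
        have h : D = 0 := by
          apply Subtype.ext
          apply Cochain.toEnd_injective
          ext a
          exact congrArg (fun d : Derivation K A A => d a) hD
        rw [h, map_zero]
      · intro D
        refine ⟨HH.mk K A 1 ⟨MultilinearMap.ofSubsingleton K A A 0 D.toLinearMap,
          mem_cocycles_one_iff.2 fun a b => ?_⟩, ?_⟩
        · change D (a * b) = a * D b + D a * b
          rw [D.leibniz, smul_eq_mul, smul_eq_mul, mul_comm b]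
        · ext a
          rfl)

theorem derivationLieEquiv_mk (f : cocycles K A 1) :
    derivationLieEquiv K A (HH.mk K A 1 f) = toDerivation K A f :=
  rfl

/-- Over a commutative algebra the Hochschild differential is linear over the algebra, not only over
`K`. -/
theorem smul_mem_cocycles {n : ℕ} (b : A) {f : Cochain K A n} (hf : f ∈ cocycles K A n) :
    b • f ∈ cocycles K A n := by
  have hf' : delta K A n f = 0 := hf
  change delta K A n (b • f) = 0
  have : delta K A n (b • f) = b • delta K A n f := by
    ext x
    change _ = b * delta K A n f x
    rw [delta_apply, delta_apply]
    simp only [smul_apply, smul_eq_mul, mul_add, mul_sum, mul_smul_comm]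
    rw [mul_left_comm, mul_assoc]
  rw [this, hf', smul_zero]

theorem bracketOne_smul {n : ℕ} (D : cocycles K A 1) (b : A) (f : Cochain K A n) :
    bracketOne K A n D (b • f) =
      toDerivation K A D b • f + b • bracketOne K A n (D : Cochain K A 1) f := by
  ext x
  have h := mem_cocycles_one_iff.1 D.2 b (f x)
  change _ = toDerivation K A D b * f x + b * bracketOne K A n (D : Cochain K A 1) f x
  rw [bracketOne_apply, bracketOne_apply, smul_apply, smul_eq_mul, h]
  simp only [smul_apply, smul_eq_mul, ← mul_sum]
  change b * _ + (D : Cochain K A 1) _ * f x - _ = (D : Cochain K A 1) _ * f x + _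
  ring

end Derivation

/-! ### Hochschild cochains of a commutative group algebra -/

section GroupAlgebra

variable {K G : Type*} [CommRing K] [CommGroup G]

/-- The group cochain `y ↦ (y₁ ⋯ yₙ)⁻¹ f(y₁, …, yₙ)` of a Hochschild cochain `f`. -/
noncomputable def toGroup (K G : Type*) [CommRing K] [CommGroup G] (n : ℕ) :
    Cochain K (MonoidAlgebra K G) n →ₗ[K] ((Fin n → G) → MonoidAlgebra K G) where
  toFun f y := MonoidAlgebra.of K G (∏ i, y i)⁻¹ * f fun i => MonoidAlgebra.of K G (y i)
  map_add' f g := by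
    funext y
    simp [mul_add]
  map_smul' c f := by
    funext y
    simp

theorem toGroup_apply {n : ℕ} (f : Cochain K (MonoidAlgebra K G) n) (y : Fin n → G) :
    toGroup K G n f y =
      MonoidAlgebra.of K G (∏ i, y i)⁻¹ * f fun i => MonoidAlgebra.of K G (y i) :=
  rfl

theorem of_prod_mul_toGroup {n : ℕ} (f : Cochain K (MonoidAlgebra K G) n) (y : Fin n → G) :
    MonoidAlgebra.of K G (∏ i, y i) * toGroup K G n f y =
      f fun i => MonoidAlgebra.of K G (y i) := by
  rw [toGroup_apply, ← mul_assoc, ← map_mul, mul_inv_cancel, map_one, one_mul]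

theorem toGroup_smul {n : ℕ} (b : MonoidAlgebra K G) (f : Cochain K (MonoidAlgebra K G) n) :
    toGroup K G n (b • f) = b • toGroup K G n f := by
  funext y
  exact mul_left_comm _ _ _

theorem toGroup_injective (n : ℕ) : Function.Injective (toGroup K G n) := by
  intro f f' h
  refine Module.Basis.ext_multilinear (fun _ => MonoidAlgebra.basis G K) fun y => ?_
  have := congrArg (MonoidAlgebra.of K G (∏ i, y i) * ·) (congrFun h y)
  simpa only [of_prod_mul_toGroup, GroupCochain.basis_eq_of] using this

/-- A multilinear map takes arbitrary values on tuples of basis elements; the preimage is a sum of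
products of dual basis vectors. -/
theorem toGroup_surjective [Finite G] (n : ℕ) : Function.Surjective (toGroup K G n) := by
  classical
  have := Fintype.ofFinite G
  intro φ
  refine ⟨∑ z : Fin n → G, ((MultilinearMap.mkPiAlgebra K (Fin n) K).compLinearMap
    fun i => (MonoidAlgebra.basis G K).coord (z i)).smulRight
      (MonoidAlgebra.of K G (∏ i, z i) * φ z), ?_⟩
  funext y
  have h : ∀ z : Fin n → G, ∏ i, (MonoidAlgebra.basis G K).coord (z i)
      (MonoidAlgebra.of K G (y i)) = if z = y then 1 else 0 := by
    intro z
    have e : ∀ i, (MonoidAlgebra.basis G K).coord (z i) (MonoidAlgebra.of K G (y i)) =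
        if z i = y i then 1 else 0 := by
      intro i
      rw [← GroupCochain.basis_eq_of, Module.Basis.coord_apply, Module.Basis.repr_self,
        Finsupp.single_apply]
      simp only [eq_comm]
    simp only [e]
    rw [Fintype.prod_ite_zero]
    simp [funext_iff]
  rw [toGroup_apply, _root_.sum_apply]
  simp only [MultilinearMap.smulRight_apply, MultilinearMap.compLinearMap_apply,
    MultilinearMap.mkPiAlgebra_apply, h, ite_smul, one_smul, zero_smul]
  rw [sum_ite_eq' univ y, if_pos (mem_univ y), ← mul_assoc, ← map_mul, inv_mul_cancel, map_one,
    one_mul]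

theorem prod_contractNth {n : ℕ} (i : Fin n) (y : Fin (n + 1) → G) :
    ∏ j, Fin.contractNth i.castSucc (· * ·) y j = ∏ j, y j := by
  induction n with
  | zero => exact i.elim0
  | succ n ih =>
    rw [← Fin.cons_self_tail y]
    induction i using Fin.cases with
    | zero =>
      rw [GroupCochain.contractNth_zero_cons, Fin.prod_cons, Fin.prod_cons, mul_assoc,
        Fin.prod_univ_succ (Fin.tail y)]
      rfl
    | succ i => rw [GroupCochain.contractNth_succ_cons, Fin.prod_cons, Fin.prod_cons, ih]

theorem toGroup_delta {n : ℕ} (f : Cochain K (MonoidAlgebra K G) n) :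
    toGroup K G (n + 1) (delta K (MonoidAlgebra K G) n f) =
      GroupCochain.d (toGroup K G n f) := by
  funext y
  have hc : ∀ i : Fin n, (Fin.contractNth i.castSucc (· * ·)
      fun j => MonoidAlgebra.of K G (y j)) =
      fun j => MonoidAlgebra.of K G (Fin.contractNth i.castSucc (· * ·) y j) := fun i =>
    (Fin.comp_contractNth (· * ·) (· * ·) (f := MonoidAlgebra.of K G)
      (fun a b => map_mul _ a b) i.castSucc y).symm
  rw [toGroup_apply, delta_apply]
  simp only [hc]
  change MonoidAlgebra.of K G (∏ i, y i)⁻¹ * (MonoidAlgebra.of K G (y 0) *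
      f (fun j => MonoidAlgebra.of K G (Fin.tail y j)) + _ + _ • (f (fun j =>
        MonoidAlgebra.of K G (Fin.init y j)) * MonoidAlgebra.of K G (y (Fin.last n)))) = _
  simp only [← of_prod_mul_toGroup, prod_contractNth, GroupCochain.d]
  have h0 : y 0 * ∏ i, Fin.tail y i = ∏ i, y i := (Fin.prod_univ_succ y).symm
  have h1 : (∏ i, Fin.init y i) * y (Fin.last n) = ∏ i, y i := (Fin.prod_univ_castSucc y).symm
  rw [mul_right_comm, ← mul_assoc (MonoidAlgebra.of K G (y 0)), ← map_mul, ← map_mul, h0, h1]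
  simp only [mul_add, mul_sum, mul_smul_comm, ← mul_assoc, ← map_mul, inv_mul_cancel, map_one,
    one_mul]
  -- The Hochschild differential takes its signs in `K`, the group differential in `ℤ`.
  have hs : ∀ (k : ℕ) (a : MonoidAlgebra K G), (-1 : K) ^ k • a = (-1 : ℤ) ^ k • a := by
    intro k a
    rcases neg_one_pow_eq_or K k with h | h <;> rcases Nat.even_or_odd k with h' | h' <;>
      simp [h'.neg_one_pow]
  simp only [hs]

open GroupCochain in
-- Write `f(y) = (∏ y) φ(y)`. As the Euler derivation kills `φ(y)`, applying `D` to `f(y)`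
-- multiplies it by `h * ∑ log (y l)`. Applying `D` to the argument `y l` instead gives `log (y l)`
-- times `f` with `h * y l` in that slot, whose product of arguments has the same extra factor `h`.
-- The difference is the weighted defect.
theorem toGroup_bracketOne (L : Log G) (hK : (Nat.card G : K) = 0) (h : G) {n : ℕ}
    {D : cocycles K (MonoidAlgebra K G) 1}
    (hD : toDerivation K (MonoidAlgebra K G) D = MonoidAlgebra.of K G h • euler L hK)
    (f : Cochain K (MonoidAlgebra K G) n) (hf : ∀ y, euler L hK (toGroup K G n f y) = 0) :
    toGroup K G n (bracketOne K (MonoidAlgebra K G) n D f) =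
      MonoidAlgebra.of K G h • translationDefect L h (toGroup K G n f) := by
  funext y
  have hD' : ∀ a, (D : Cochain K (MonoidAlgebra K G) 1).toEnd a =
      MonoidAlgebra.of K G h * euler L hK a := fun a =>
    congrArg (fun d : Derivation K (MonoidAlgebra K G) (MonoidAlgebra K G) => d a) hD
  have hu : ∀ l, f (Function.update (fun i => MonoidAlgebra.of K G (y i)) l
      ((D : Cochain K (MonoidAlgebra K G) 1).toEnd (MonoidAlgebra.of K G (y l)))) =
      (L.log (y l) : K) • (MonoidAlgebra.of K G (h * ∏ i, y i) *
        toGroup K G n f (Function.update y l (h * y l))) := by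
    intro l
    have e1 : (Function.update (fun i => MonoidAlgebra.of K G (y i)) l
        (MonoidAlgebra.of K G (h * y l))) =
        fun i => MonoidAlgebra.of K G (Function.update y l (h * y l) i) := by
      funext i
      by_cases hi : i = l
      · subst hi; simp
      · simp [hi]
    have e2 : ∏ i, Function.update y l (h * y l) i = h * ∏ i, y i := by
      rw [prod_update_of_mem (mem_univ l), mul_assoc, ← prod_update_of_mem (mem_univ l),
        Function.update_eq_self]
    rw [hD', euler_of, mul_smul_comm, ← map_mul, f.map_update_smul, e1, ← of_prod_mul_toGroup, e2]
  change MonoidAlgebra.of K G (∏ i, y i)⁻¹ * bracketOne K (MonoidAlgebra K G) n D f _ =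
    MonoidAlgebra.of K G h * _
  rw [bracketOne_apply]
  simp only [hu]
  rw [hD', ← of_prod_mul_toGroup, (euler L hK).leibniz, hf, euler_of, L.cast_log_prod hK, smul_zero,
    zero_add, smul_eq_mul, translationDefect]
  simp only [map_mul (MonoidAlgebra.of K G) h, ← Nat.cast_smul_eq_nsmul K, smul_sub,
    sum_sub_distrib, mul_sub, mul_sum, sum_smul, mul_smul_comm]
  have e : MonoidAlgebra.of K G (∏ i, y i)⁻¹ * MonoidAlgebra.of K G (∏ i, y i) = 1 := by
    rw [← map_mul, inv_mul_cancel, map_one]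
  congr 1
  · refine sum_congr rfl fun i _ => ?_
    congr 1
    linear_combination MonoidAlgebra.of K G h * toGroup K G n f y * e
  · refine sum_congr rfl fun i _ => ?_
    congr 1
    linear_combination MonoidAlgebra.of K G h *
      toGroup K G n f (Function.update y i (h * y i)) * e

end GroupAlgebra

end Hochschild

/-! ### Hochschild cohomology of the group algebra of a cyclic group -/

namespace Hochschild

open Finset GroupCochain

variable {K G : Type*} [CommRing K] [CommGroup G] (L : Log G)

theorem d_toGroup_eq_zero {n : ℕ} (f : cocycles K (MonoidAlgebra K G) n) :
    d (toGroup K G n f) = 0 := by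
  have hf : delta K (MonoidAlgebra K G) n f = 0 := f.2
  rw [← toGroup_delta, hf, map_zero]

/-- The values of `base` are natural numbers in `KG`, which every derivation kills. -/
theorem euler_base (hK : (Nat.card G : K) = 0) :
    (n : ℕ) → (y : Fin n → G) → euler L hK (base L (MonoidAlgebra K G) n y) = 0
  | 0, _ => (euler L hK).map_one_eq_zero
  | 1, y => (euler L hK).map_natCast (L.log (y 0))
  | n + 2, y => by
    change euler L hK (L.carry (y 0) (y 1) • base L (MonoidAlgebra K G) n _) = 0
    rw [map_nsmul, euler_base hK n, smul_zero]

/-- The class in `HH¹(KG)` of the multiple `a • E` of the Euler derivation `E`. -/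
noncomputable def eulerClass (hK : (Nat.card G : K) = 0) (h1 : L.log L.gen = 1) :
    MonoidAlgebra K G ≃ₗ[K] HH K (MonoidAlgebra K G) 1 :=
  derivationEquiv L hK h1 ≪≫ₗ
    (derivationLieEquiv K (MonoidAlgebra K G)).toLinearEquiv.symm

theorem derivationLieEquiv_eulerClass (hK : (Nat.card G : K) = 0) (h1 : L.log L.gen = 1)
    (a : MonoidAlgebra K G) :
    derivationLieEquiv K (MonoidAlgebra K G) (eulerClass L hK h1 a) =
      derivationEquiv L hK h1 a :=
  (derivationLieEquiv K (MonoidAlgebra K G)).toLinearEquiv.apply_symm_apply _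

variable [Fintype G]

theorem mem_coboundaries_of_isCoboundary : {n : ℕ} → {f : Cochain K (MonoidAlgebra K G) n} →
    IsCoboundary (toGroup K G n f) → f ∈ coboundaries K (MonoidAlgebra K G) n
  | 0, f, h => by
    have h' : toGroup K G 0 f = 0 := h
    exact toGroup_injective 0 (h'.trans (map_zero _).symm)
  | n + 1, f, h => by
    obtain ⟨η, hη⟩ := h
    obtain ⟨e, rfl⟩ := toGroup_surjective n η
    exact ⟨e, toGroup_injective (n + 1) ((toGroup_delta e).trans hη)⟩

/-- Evaluation of Hochschild classes. -/
noncomputable def evHH (hK : (Nat.card G : K) = 0) (n : ℕ) :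
    HH K (MonoidAlgebra K G) n →ₗ[K] MonoidAlgebra K G :=
  HH.lift
    { toFun := fun f => ev L n (toGroup K G n f)
      map_add' := fun f f' => by
        rw [Submodule.coe_add, map_add, ev_add]
      map_smul' := fun c f => by
        rw [Submodule.coe_smul, map_smul, ev_smul, RingHom.id_apply] }
    (by
      rintro ⟨f, hf⟩ h
      change ev L n (toGroup K G n f) = 0
      cases n with
      | zero =>
        have h' : f = 0 := h
        rw [h', map_zero, ev_zero]
      | succ n =>
        obtain ⟨e, rfl⟩ : ∃ e, delta K (MonoidAlgebra K G) n e = f := h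
        rw [toGroup_delta, ev_d L (natCard_smul_eq_zero hK)])

theorem evHH_mk (hK : (Nat.card G : K) = 0) {n : ℕ} (f : cocycles K (MonoidAlgebra K G) n) :
    evHH L hK n (HH.mk K (MonoidAlgebra K G) n f) = ev L n (toGroup K G n f) :=
  rfl

theorem evHH_injective (hK : (Nat.card G : K) = 0) (n : ℕ) :
    Function.Injective (evHH L hK n) := by
  refine (injective_iff_map_eq_zero _).2 fun ξ hξ => ?_
  obtain ⟨f, rfl⟩ := HH.mk_surjective _ ξ
  exact HH.mk_eq_zero.2 (mem_coboundaries_of_isCoboundary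
    (isCoboundary_of_ev_eq_zero L n _ (d_toGroup_eq_zero f) hξ))

theorem exists_cocycle_toGroup_eq_base (hK : (Nat.card G : K) = 0) (n : ℕ) :
    ∃ f : cocycles K (MonoidAlgebra K G) n,
      toGroup K G n f = base L (MonoidAlgebra K G) n := by
  obtain ⟨f, hf⟩ := toGroup_surjective n (base L (MonoidAlgebra K G) n)
  refine ⟨⟨f, ?_⟩, hf⟩
  apply toGroup_injective (n + 1)
  rw [toGroup_delta, hf, d_base L _ (natCard_smul_eq_zero hK), map_zero]

theorem evHH_mk_smul (hK : (Nat.card G : K) = 0) (h1 : L.log L.gen = 1) {n : ℕ}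
    {c : cocycles K (MonoidAlgebra K G) n}
    (hc : toGroup K G n c = base L (MonoidAlgebra K G) n) (b : MonoidAlgebra K G) :
    evHH L hK n (HH.mk K (MonoidAlgebra K G) n
      ⟨b • (c : Cochain K (MonoidAlgebra K G) n), smul_mem_cocycles b c.2⟩) = b := by
  rw [evHH_mk, toGroup_smul, hc, ev_smul, ev_base L _ h1, smul_eq_mul, mul_one]

/-- Every `HHⁿ(KG)` is isomorphic to `KG` as a vector space. -/
noncomputable def evEquiv (hK : (Nat.card G : K) = 0) (h1 : L.log L.gen = 1) (n : ℕ) :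
    HH K (MonoidAlgebra K G) n ≃ₗ[K] MonoidAlgebra K G :=
  LinearEquiv.ofBijective (evHH L hK n) ⟨evHH_injective L hK n, fun b => by
    obtain ⟨c, hc⟩ := exists_cocycle_toGroup_eq_base L hK n
    exact ⟨_, evHH_mk_smul L hK h1 hc b⟩⟩

/-! ### The action of the first cohomology -/

/-- Every class is `b • [c]`, where `b` is its evaluation, so the Leibniz rule `bracketOne_smul`
reduces the action to the bracket with the single class `[c]`. -/
theorem evHH_lie (hK : (Nat.card G : K) = 0) (h1 : L.log L.gen = 1) {n : ℕ}
    {c : cocycles K (MonoidAlgebra K G) n}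
    (hc : toGroup K G n c = base L (MonoidAlgebra K G) n)
    (D : HH K (MonoidAlgebra K G) 1) (ξ : HH K (MonoidAlgebra K G) n) :
    evHH L hK n ⁅D, ξ⁆ = derivationLieEquiv K (MonoidAlgebra K G) D (evHH L hK n ξ) +
      evHH L hK n ξ * evHH L hK n ⁅D, HH.mk K (MonoidAlgebra K G) n c⁆ := by
  obtain ⟨D, rfl⟩ := HH.mk_surjective _ D
  obtain ⟨b, rfl⟩ : ∃ b : MonoidAlgebra K G, HH.mk K (MonoidAlgebra K G) n
      ⟨b • (c : Cochain K (MonoidAlgebra K G) n), smul_mem_cocycles b c.2⟩ = ξ :=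
    ⟨evHH L hK n ξ, evHH_injective L hK n (evHH_mk_smul L hK h1 hc _)⟩
  rw [evHH_mk_smul L hK h1 hc, derivationLieEquiv_mk, lie_def, lie_def, bracketHH_mk, bracketHH_mk,
    evHH_mk, evHH_mk]
  change ev L n (toGroup K G n (bracketOne K (MonoidAlgebra K G) n D
    (b • (c : Cochain K (MonoidAlgebra K G) n)))) = _ + b * ev L n (toGroup K G n
      (bracketOne K (MonoidAlgebra K G) n D (c : Cochain K (MonoidAlgebra K G) n)))
  rw [bracketOne_smul, map_add, toGroup_smul, toGroup_smul, ev_add, ev_smul, ev_smul, hc,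
    ev_base L _ h1, smul_eq_mul, smul_eq_mul, mul_one]

theorem evHH_lie_base_of (hK : (Nat.card G : K) = 0) (h1 : L.log L.gen = 1) {n : ℕ}
    {c : cocycles K (MonoidAlgebra K G) n}
    (hc : toGroup K G n c = base L (MonoidAlgebra K G) n) (h : G) :
    evHH L hK n ⁅eulerClass L hK h1 (MonoidAlgebra.of K G h), HH.mk K (MonoidAlgebra K G) n c⁆ =
      MonoidAlgebra.of K G h *
        ev L n (translationDefect L h (base L (MonoidAlgebra K G) n)) := by
  obtain ⟨D, hD⟩ := HH.mk_surjective _ (eulerClass L hK h1 (MonoidAlgebra.of K G h))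
  have hD' : toDerivation K (MonoidAlgebra K G) D = MonoidAlgebra.of K G h • euler L hK := by
    rw [← derivationLieEquiv_mk, hD, derivationLieEquiv_eulerClass]
    rfl
  rw [← hD, lie_def, bracketHH_mk, evHH_mk]
  change ev L n (toGroup K G n (bracketOne K (MonoidAlgebra K G) n D
    (c : Cochain K (MonoidAlgebra K G) n))) = _
  rw [toGroup_bracketOne L hK h hD' _ (by rw [hc]; exact euler_base L hK n), hc, ev_smul,
    smul_eq_mul]

theorem evHH_lie_base_even (hK : (Nat.card G : K) = 0) (h1 : L.log L.gen = 1) {n : ℕ}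
    (hn : Even n) {c : cocycles K (MonoidAlgebra K G) n}
    (hc : toGroup K G n c = base L (MonoidAlgebra K G) n) (a : MonoidAlgebra K G) :
    evHH L hK n ⁅eulerClass L hK h1 a, HH.mk K (MonoidAlgebra K G) n c⁆ = 0 := by
  have key : evHH L hK n ∘ₗ (bracketHH K (MonoidAlgebra K G) n).flip
      (HH.mk K (MonoidAlgebra K G) n c) ∘ₗ (eulerClass L hK h1).toLinearMap = 0 := by
    -- The bracket is linear in `a`, so it suffices to take a group element `h`.
    refine (MonoidAlgebra.basis G K).ext fun h => ?_
    refine (evHH_lie_base_of L hK h1 hc h).trans ?_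
    obtain ⟨k, rfl⟩ := hn.two_dvd
    rw [ev_translationDefect_base_even L _ h1 (natCard_smul_eq_zero hK), mul_zero]
    rfl
  exact LinearMap.congr_fun key a

theorem evHH_lie_base_odd (hK : (Nat.card G : K) = 0) (h1 : L.log L.gen = 1) {n : ℕ}
    (hn : Odd n) {c : cocycles K (MonoidAlgebra K G) n}
    (hc : toGroup K G n c = base L (MonoidAlgebra K G) n) (a : MonoidAlgebra K G) :
    evHH L hK n ⁅eulerClass L hK h1 a, HH.mk K (MonoidAlgebra K G) n c⁆ = -euler L hK a := by
  have key : evHH L hK n ∘ₗ (bracketHH K (MonoidAlgebra K G) n).flip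
      (HH.mk K (MonoidAlgebra K G) n c) ∘ₗ (eulerClass L hK h1).toLinearMap =
      -(euler L hK).toLinearMap := by
    refine (MonoidAlgebra.basis G K).ext fun h => ?_
    refine (evHH_lie_base_of L hK h1 hc h).trans ?_
    obtain ⟨k, rfl⟩ := hn
    rw [ev_translationDefect_base_odd L _ h1 (natCard_smul_eq_zero hK)]
    change _ = -euler L hK (MonoidAlgebra.of K G h)
    rw [euler_of, mul_neg, mul_comm, ← nsmul_eq_mul, Nat.cast_smul_eq_nsmul]
  exact LinearMap.congr_fun key a

theorem evEquiv_lie_even (hK : (Nat.card G : K) = 0) (h1 : L.log L.gen = 1) {n : ℕ}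
    (hn : Even n) (D : HH K (MonoidAlgebra K G) 1) (ξ : HH K (MonoidAlgebra K G) n) :
    evEquiv L hK h1 n ⁅D, ξ⁆ =
      derivationLieEquiv K (MonoidAlgebra K G) D (evEquiv L hK h1 n ξ) := by
  obtain ⟨c, hc⟩ := exists_cocycle_toGroup_eq_base (K := K) L hK n
  obtain ⟨a, rfl⟩ := (eulerClass L hK h1).surjective D
  refine (evHH_lie L hK h1 hc _ ξ).trans ?_
  rw [evHH_lie_base_even L hK h1 hn hc, mul_zero, add_zero]
  rfl

/-- For `D = aE` and evaluation `b` of `ξ`, the class `⁅D, ξ⁆` evaluates to `a E(b) - b E(a)`, which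
is the coefficient of `⁅aE, bE⁆`. -/
theorem evEquiv_lie_odd (hK : (Nat.card G : K) = 0) (h1 : L.log L.gen = 1) {n : ℕ}
    (hn : Odd n) (D : HH K (MonoidAlgebra K G) 1) (ξ : HH K (MonoidAlgebra K G) n) :
    derivationEquiv L hK h1 (evEquiv L hK h1 n ⁅D, ξ⁆) =
      ⁅derivationLieEquiv K (MonoidAlgebra K G) D,
        derivationEquiv L hK h1 (evEquiv L hK h1 n ξ)⁆ := by
  obtain ⟨c, hc⟩ := exists_cocycle_toGroup_eq_base (K := K) L hK n
  obtain ⟨a, rfl⟩ := (eulerClass L hK h1).surjective D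
  rw [derivationLieEquiv_eulerClass, lie_derivationEquiv]
  congr 1
  refine (evHH_lie L hK h1 hc _ ξ).trans ?_
  rw [evHH_lie_base_odd L hK h1 hn hc, derivationLieEquiv_eulerClass, derivationEquiv_apply,
    mul_neg, ← sub_eq_add_neg]
  rfl

end Hochschild

theorem mainTheorem5 (p : ℕ) (hp : p.Prime) (hp2 : p ≠ 2)
    (K : Type*) [Field K] [CharP K p]
    (G : Type*) [CommGroup G] [Finite G] [IsCyclic G] (hG : p ∣ Nat.card G) :
    -- `HH¹(KG)` is the Lie algebra of derivations of `KG`, via `[f] ↦ (a ↦ f a)`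
    ∃ θ : Hochschild.HH K (MonoidAlgebra K G) 1 ≃ₗ⁅K⁆
        Derivation K (MonoidAlgebra K G) (MonoidAlgebra K G),
      (∀ (f : Hochschild.cocycles K (MonoidAlgebra K G) 1) (a : MonoidAlgebra K G),
        θ (Hochschild.HH.mk K (MonoidAlgebra K G) 1 f) a =
          (f : Hochschild.Cochain K (MonoidAlgebra K G) 1) fun _ => a) ∧
      -- which is the Witt algebra with basis `D_i`, `D_i(g) = g^{i+1}`
      (∀ g : G, (∀ x : G, x ∈ Subgroup.zpowers g) →
        ∃ D : Module.Basis (ZMod (Nat.card G)) K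
            (Derivation K (MonoidAlgebra K G) (MonoidAlgebra K G)),
          (∀ i, D i (MonoidAlgebra.of K G g) = MonoidAlgebra.of K G (g ^ (i.val + 1))) ∧
          ∀ i j, ⁅D i, D j⁆ = ((j.val : K) - (i.val : K)) • D (i + j)) ∧
      -- in odd degree, `HHⁿ(KG)` is the adjoint module
      (∀ n : ℕ, Odd n →
        ∃ e : Hochschild.HH K (MonoidAlgebra K G) n ≃ₗ[K]
            Derivation K (MonoidAlgebra K G) (MonoidAlgebra K G),
          ∀ (D : Hochschild.HH K (MonoidAlgebra K G) 1)
            (ξ : Hochschild.HH K (MonoidAlgebra K G) n), e ⁅D, ξ⁆ = ⁅θ D, e ξ⁆) ∧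
      -- in even degree, `HHⁿ(KG)` is the standard module
      (∀ n : ℕ, Even n →
        ∃ e : Hochschild.HH K (MonoidAlgebra K G) n ≃ₗ[K] MonoidAlgebra K G,
          ∀ (D : Hochschild.HH K (MonoidAlgebra K G) 1)
            (ξ : Hochschild.HH K (MonoidAlgebra K G) n), e ⁅D, ξ⁆ = θ D (e ξ)) := by
  have hK : (Nat.card G : K) = 0 := (CharP.cast_eq_zero_iff K p _).2 hG
  -- In the trivial group the generator would have logarithm 0; `p ∣ |G|` excludes this.
  have hcard : 1 < Nat.card G := hp.one_lt.trans_le (Nat.le_of_dvd Nat.card_pos hG)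
  have hgen : ∀ L : GroupCochain.Log G, L.log L.gen = 1 := fun L => by
    have h := L.log_gen_pow 1
    rwa [pow_one, Nat.mod_eq_of_lt hcard] at h
  have := Fintype.ofFinite G
  obtain ⟨g₀, hg₀⟩ := IsCyclic.exists_generator (α := G)
  obtain ⟨L, -⟩ := GroupCochain.Log.exists_of_generator hg₀
  refine ⟨Hochschild.derivationLieEquiv K (MonoidAlgebra K G), fun _ _ => rfl, ?_, ?_, ?_⟩
  · intro g hg
    -- The Witt basis is adapted to the given generator `g`, so the logarithm is taken to base `g`
    -- and not `g₀`.
    obtain ⟨L, rfl⟩ := GroupCochain.Log.exists_of_generator hg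
    exact GroupCochain.exists_witt_basis L hK (hgen L)
  · intro n hn
    exact ⟨Hochschild.evEquiv L hK (hgen L) n ≪≫ₗ GroupCochain.derivationEquiv L hK (hgen L),
      Hochschild.evEquiv_lie_odd L hK (hgen L) hn⟩
  · intro n hn
    exact ⟨Hochschild.evEquiv L hK (hgen L) n, Hochschild.evEquiv_lie_even L hK (hgen L) hn⟩
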